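/- Let $n\ge 1$. Throughout, $\rho:(0,\infty)\to(0,\infty)$ is measurable and $$I_\rho f(x)=\int_{\mathbb R^n}\frac{\rho(|x-y|)}{|x-y|^n}\,f(y)\,dy .$$ **Definitions.** A Young function is a convex, left-continuous $\Phi:[0,\infty]\to[0,\infty]$ with $\lim_{r\to0+}\Phi(r)=\Phi(0)=0$ and $\lim_{r\to\infty}\Phi(r)=\Phi(\infty)=\infty$. Put $\Phi^{-1}(s)=\inf\{r\ge0:\Phi(r)>s\}$ (with $\inf\emptyset=\infty$), and write $\Phi\in\nabla_2$ if there is $C>1$ with $\Phi(r)\le\frac1{2C}\Phi(Cr)$ for all $r\ge0$. Let $$\|f\|_{L^\Phi}=\inf\Big\{\lambda>0:\int_{\mathbb R^n}\Phi\Big(\frac{|f|}{\lambda}\Big)dx\le1\Big\},\qquad \|f\|_{WL^\Phi}=\sup_{\lambda>0}\big\|\lambda\,\chi_{\{|f|>\lambda\}}\big\|_{L^\Phi}.$$ For $\varphi:(0,\infty)\to(0,\infty)$ measurable, $\mathcal M^{\Phi,\varphi}$ (respectively $W\mathcal M^{\Phi,\varphi}$) is the space of all measurable functions $f$ that are locally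 in $L^\Phi$ (respectively $WL^\Phi$), that is, $f\chi_B$ belongs to that space for every ball $B$, and for which $$\sup_{x\in\mathbb R^n,\,r>0}\varphi(r)^{-1}\Phi^{-1}(r^{-n})\,\|f\chi_{B(x,r)}\|<\infty ,$$ where the norm inside is that of $L^\Phi$ (respectively $WL^\Phi$); the supremum is the (quasi-)norm of $f$. The space $W\mathcal M^{1,\varphi}$ is $W\mathcal M^{\Phi,\varphi}$ for $\Phi(t)=t$. A function $g:(0,\infty)\to(0,\infty)$ is almost increasing (almost decreasing) if there is $C>0$ with $g(r)\le Cg(s)$ (respectively $g(r)\ge Cg(s)$) whenever $0<r\le s$. The class $\mathcal G_\Phi$ consists of all $\varphi:(0,\infty)\to(0,\infty)$ such that $t\mapsto\varphi(t)/\Phi^{-1}(t^{-n})$ is almost increasing and $t\mapsto\varphi(t)/(\Phi^{-1}(t^{-n})t^n)$ is almost decreasing. "$I_\rho$ is bounded from $X$ to $Y$" means that there is a constant $C<\infty$ such that for every $f\in X$ the integral $I_\rho f(x)$ converges absolutely for almost every $x$, $I_\rho f\in Y$, and $\|I_\rho f\|_Y\le C\|f\|_X$. Two conditions on $\rho$ will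 be used: $$\text{(a)}\ \int_0^1\frac{\rho(t)}t\,dt<\infty;\qquad \text{(b)}\ \sup_{r/2\le t\le r}\rho(t)\le C\int_{k_1r}^{k_2r}\frac{\rho(t)}t\,dt\ \text{ for all } r>0,$$ in (b) for some constants $C>0$ and $0<k_1<k_2$. **Theorem.** Let $\Phi$ be a Young function and let $\varphi\in\mathcal G_\Phi$ be measurable and almost decreasing. Let $\beta\in(0,1)$, $\eta(t)=\varphi(t)^\beta$ and $\Psi(t)=\Phi(t^{1/\beta})$. 1. Let $\rho$ satisfy (a) and (b). If there is $C>0$ such that for all $r>0$ $$\varphi(r)\int_0^r\frac{\rho(t)}t\,dt+\int_r^\infty\rho(t)\varphi(t)\,\frac{dt}t\le C\,\eta(r),$$ then $I_\rho$ is bounded from $\mathcal M^{\Phi,\varphi}$ to $W\mathcal M^{\Psi,\eta}$; if moreover $\Phi\in\nabla_2$, then $I_\rho$ is bounded from $\mathcal M^{\Phi,\varphi}$ to $\mathcal M^{\Psi,\eta}$. 2. If $I_\rho$ is bounded from $\mathcal M^{\Phi,\varphi}$ to $W\mathcal M^{1,\eta}$, or from $\mathcal M^{\Phi,\varphi}$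 to $\mathcal M^{\Psi,\eta}$, then there is $C>0$ such that for all $r>0$ $$\varphi(r)\int_0^r\frac{\rho(t)}t\,dt\le C\,\eta(r).\qquad(*)$$ 3. Let $\rho$ satisfy (a) and (b), and assume that there is $C>0$ such that for all $r>0$ $$\int_r^\infty\rho(t)\varphi(t)\,\frac{dt}t\le C\,\rho(r)\varphi(r).$$ Then $(*)$ (for some $C>0$ and all $r>0$) holds if and only if $I_\rho$ is bounded from $\mathcal M^{\Phi,\varphi}$ to $W\mathcal M^{\Psi,\eta}$. If moreover $\Phi\in\nabla_2$, then $(*)$ holds if and only if $I_\rho$ is bounded from $\mathcal M^{\Phi,\varphi}$ to $\mathcal M^{\Psi,\eta}$. -/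

import Mathlib

open MeasureTheory Set Filter Topology
open scoped ENNReal NNReal

noncomputable section

namespace OrliczMorrey

/-- A Young function `Φ : [0,∞] → [0,∞]`: convex, left-continuous, with
`lim_{r → 0+} Φ r = Φ 0 = 0` and `lim_{r → ∞} Φ r = Φ ∞ = ∞`. -/
structure IsYoung (Φ : ℝ≥0∞ → ℝ≥0∞) : Prop where
  convex : ConvexOn ℝ≥0 univ Φ
  leftCont : ∀ r, ContinuousWithinAt Φ (Iio r) r
  map_zero : Φ 0 = 0
  tendsto_zero : Tendsto Φ (𝓝[>] 0) (𝓝 0)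
  map_top : Φ ∞ = ∞
  tendsto_top : Tendsto Φ (𝓝[<] ∞) (𝓝 ∞)

/-- The generalized inverse `Φ⁻¹(s) = inf {r ≥ 0 : Φ r > s}`, with `inf ∅ = ∞`. -/
def youngInv (Φ : ℝ≥0∞ → ℝ≥0∞) (s : ℝ≥0∞) : ℝ≥0∞ := sInf {r | s < Φ r}

/-- The `∇₂` condition: `Φ r ≤ Φ (C r) / (2 C)` for all `r ≥ 0`, for some `C > 1`. -/
def Nabla2 (Φ : ℝ≥0∞ → ℝ≥0∞) : Prop :=
  ∃ C : ℝ≥0, 1 < C ∧ ∀ r, r ≠ ∞ → Φ r ≤ Φ (C * r) / (2 * C)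

/-- `n`-dimensional Euclidean space. -/
abbrev E (n : ℕ) := EuclideanSpace ℝ (Fin n)

variable {𝕜 : Type*} [RCLike 𝕜] {n : ℕ}

/-- The Luxemburg functional of a nonnegative function `g`:
`inf {0 < λ < ∞ : ∫ Φ (g / λ) ≤ 1}`, with `inf ∅ = ∞`. -/
def luxemburg (Φ : ℝ≥0∞ → ℝ≥0∞) (g : E n → ℝ≥0∞) : ℝ≥0∞ :=
  sInf {l | 0 < l ∧ l < ∞ ∧ ∫⁻ x, Φ (g x / l) ≤ 1}

/-- The Orlicz norm of `f` (Luxemburg-Nakano norm of `|f|`). -/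
def orliczNorm (Φ : ℝ≥0∞ → ℝ≥0∞) (f : E n → 𝕜) : ℝ≥0∞ :=
  luxemburg Φ (fun x => ‖f x‖ₑ)

/-- The weak Orlicz quasi-norm `sup_{l > 0} ‖l χ_{(l,∞)}(|f|)‖_{L^Φ}`. -/
def weakOrliczNorm (Φ : ℝ≥0∞ → ℝ≥0∞) (f : E n → 𝕜) : ℝ≥0∞ :=
  ⨆ (l : ℝ≥0) (_ : 0 < l), luxemburg Φ ({x | (l : ℝ≥0∞) < ‖f x‖ₑ}.indicator fun _ => (l : ℝ≥0∞))

/-- Membership in the Orlicz space `L^Φ(ℝⁿ)`. -/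
def MemOrlicz (Φ : ℝ≥0∞ → ℝ≥0∞) (f : E n → 𝕜) : Prop :=
  LocallyIntegrable f ∧ ∃ k : ℝ≥0, 0 < k ∧ ∫⁻ x, Φ (k * ‖f x‖ₑ) < ∞

/-- Membership in the weak Orlicz space `WL^Φ(ℝⁿ)`. -/
def MemWeakOrlicz (Φ : ℝ≥0∞ → ℝ≥0∞) (f : E n → 𝕜) : Prop :=
  AEStronglyMeasurable f ∧ weakOrliczNorm Φ f < ∞

/-- Membership in `L^Φ_loc(ℝⁿ)`: `f χ_B ∈ L^Φ` for all balls `B`. -/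
def MemOrliczLoc (Φ : ℝ≥0∞ → ℝ≥0∞) (f : E n → 𝕜) : Prop :=
  AEStronglyMeasurable f ∧ ∀ (x : E n) (r : ℝ), 0 < r → MemOrlicz Φ ((Metric.ball x r).indicator f)

/-- Membership in `WL^Φ_loc(ℝⁿ)`: `f χ_B ∈ WL^Φ` for all balls `B`. -/
def MemWeakOrliczLoc (Φ : ℝ≥0∞ → ℝ≥0∞) (f : E n → 𝕜) : Prop :=
  AEStronglyMeasurable f ∧
    ∀ (x : E n) (r : ℝ), 0 < r → MemWeakOrlicz Φ ((Metric.ball x r).indicator f)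

/-- `Φ⁻¹(r^{-n})` for `r > 0`. -/
def invPow (n : ℕ) (Φ : ℝ≥0∞ → ℝ≥0∞) (r : ℝ) : ℝ≥0∞ := youngInv Φ (ENNReal.ofReal (r ^ n)⁻¹)

/-- The norm of the generalized Orlicz-Morrey space of the third kind:
`sup_{x, r > 0} φ(r)⁻¹ Φ⁻¹(r^{-n}) ‖f χ_{B(x,r)}‖_{L^Φ}`. -/
def morreyNorm (Φ : ℝ≥0∞ → ℝ≥0∞) (φ : ℝ → ℝ) (f : E n → 𝕜) : ℝ≥0∞ :=
  ⨆ (x : E n) (r : ℝ) (_ : 0 < r),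
    (ENNReal.ofReal (φ r))⁻¹ * invPow n Φ r * orliczNorm Φ ((Metric.ball x r).indicator f)

/-- The quasi-norm of the weak generalized Orlicz-Morrey space of the third kind. -/
def weakMorreyNorm (Φ : ℝ≥0∞ → ℝ≥0∞) (φ : ℝ → ℝ) (f : E n → 𝕜) : ℝ≥0∞ :=
  ⨆ (x : E n) (r : ℝ) (_ : 0 < r),
    (ENNReal.ofReal (φ r))⁻¹ * invPow n Φ r * weakOrliczNorm Φ ((Metric.ball x r).indicator f)

/-- Membership in `𝓜^{Φ,φ}(ℝⁿ)`. -/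
def MemMorrey (Φ : ℝ≥0∞ → ℝ≥0∞) (φ : ℝ → ℝ) (f : E n → 𝕜) : Prop :=
  MemOrliczLoc Φ f ∧ morreyNorm Φ φ f < ∞

/-- Membership in `W𝓜^{Φ,φ}(ℝⁿ)`. -/
def MemWeakMorrey (Φ : ℝ≥0∞ → ℝ≥0∞) (φ : ℝ → ℝ) (f : E n → 𝕜) : Prop :=
  MemWeakOrliczLoc Φ f ∧ weakMorreyNorm Φ φ f < ∞

/-- Almost increasing functions on `(0,∞)`. -/
def AlmostIncreasing (g : ℝ → ℝ) : Prop :=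
  ∃ C : ℝ, 0 < C ∧ ∀ r s : ℝ, 0 < r → r ≤ s → g r ≤ C * g s

/-- Almost decreasing functions on `(0,∞)`. -/
def AlmostDecreasing (g : ℝ → ℝ) : Prop :=
  ∃ C : ℝ, 0 < C ∧ ∀ r s : ℝ, 0 < r → r ≤ s → C * g s ≤ g r

/-- The class `𝒢_Φ`. For a Young function, `Φ⁻¹(t^{-n})` is a positive real number, so that
`toReal` loses nothing. -/
structure MemG (n : ℕ) (Φ : ℝ≥0∞ → ℝ≥0∞) (φ : ℝ → ℝ) : Prop where
  pos : ∀ t, 0 < t → 0 < φ t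
  inc : AlmostIncreasing fun t => φ t / (invPow n Φ t).toReal
  dec : AlmostDecreasing fun t => φ t / ((invPow n Φ t).toReal * t ^ n)

/-- The integrand `y ↦ ρ(|x - y|) |x - y|^{-n} f(y)`. -/
def fracIntegrand (ρ : ℝ → ℝ) (f : E n → 𝕜) (x y : E n) : 𝕜 :=
  (ρ ‖x - y‖ / ‖x - y‖ ^ n : ℝ) • f y

/-- The generalized fractional integral `I_ρ f`. -/
def fracInt (ρ : ℝ → ℝ) (f : E n → 𝕜) (x : E n) : 𝕜 := ∫ y, fracIntegrand ρ f x y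

/-- `∫_0^r ρ(t)/t dt`, as an element of `[0,∞]`. -/
def rhoInt (ρ : ℝ → ℝ) (r : ℝ) : ℝ≥0∞ := ∫⁻ t in Ioo 0 r, ENNReal.ofReal (ρ t / t)

/-- `∫_r^∞ ρ(t) φ(t) dt/t`, as an element of `[0,∞]`. -/
def tailInt (ρ φ : ℝ → ℝ) (r : ℝ) : ℝ≥0∞ := ∫⁻ t in Ioi r, ENNReal.ofReal (ρ t * φ t / t)

/-- There are `C > 0` and `0 < k₁ < k₂` with
`sup_{r/2 ≤ t ≤ r} ρ(t) ≤ C ∫_{k₁ r}^{k₂ r} ρ(t)/t dt` for all `r > 0`. -/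
def SupCondition (ρ : ℝ → ℝ) : Prop :=
  ∃ C k₁ k₂ : ℝ, 0 < C ∧ 0 < k₁ ∧ k₁ < k₂ ∧ ∀ r, 0 < r →
    (⨆ t ∈ Icc (r / 2) r, ENNReal.ofReal (ρ t)) ≤
      ENNReal.ofReal C * ∫⁻ t in Ioo (k₁ * r) (k₂ * r), ENNReal.ofReal (ρ t / t)

variable (𝕜 n)

/-- `I_ρ` is bounded from `𝓜^{Φ,φ}(ℝⁿ)` to `𝓜^{Ψ,η}(ℝⁿ)`: for each `f` in the first space the
integral `I_ρ f (x)` converges absolutely for almost every `x`, `I_ρ f` is in the second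
space, and its norm is at most a constant times that of `f`. -/
def FracBounded (ρ : ℝ → ℝ) (Φ : ℝ≥0∞ → ℝ≥0∞) (φ : ℝ → ℝ) (Ψ : ℝ≥0∞ → ℝ≥0∞) (η : ℝ → ℝ) :
    Prop :=
  ∃ C : ℝ≥0, ∀ f : E n → 𝕜, MemMorrey Φ φ f →
    (∀ᵐ x, Integrable (fracIntegrand ρ f x)) ∧ MemMorrey Ψ η (fracInt ρ f) ∧
      morreyNorm Ψ η (fracInt ρ f) ≤ C * morreyNorm Φ φ f

/-- `I_ρ` is bounded from `𝓜^{Φ,φ}(ℝⁿ)` to the weak space `W𝓜^{Ψ,η}(ℝⁿ)`. -/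
def FracWeakBounded (ρ : ℝ → ℝ) (Φ : ℝ≥0∞ → ℝ≥0∞) (φ : ℝ → ℝ) (Ψ : ℝ≥0∞ → ℝ≥0∞)
    (η : ℝ → ℝ) : Prop :=
  ∃ C : ℝ≥0, ∀ f : E n → 𝕜, MemMorrey Φ φ f →
    (∀ᵐ x, Integrable (fracIntegrand ρ f x)) ∧ MemWeakMorrey Ψ η (fracInt ρ f) ∧
      weakMorreyNorm Ψ η (fracInt ρ f) ≤ C * morreyNorm Φ φ f

end OrliczMorrey

end

/-! Sufficiency is Hedberg's method. Let `N` exceed the Orlicz-Morrey norm of `f`, and let `M` be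
the dyadic maximal function of `|f|`. On the annulus `|x - y| ≈ 2 ^ k` the average of `|f|` is
bounded both by `M x` and, up to a constant, by `N φ(2 ^ k)`. Condition (b) and the doubling of `φ`
turn the sum over annuli into a multiple of `∫ ρ(t)/t · min (M x) (N φ(t)) dt`
(`exists_lintegral_fracKernel_mul_le`).

Put `v = M x / N`, choose `r` with `φ(r) ≈ v`, and use `v` below `r` and `φ` above. The hypothesis
bounds the integral by a multiple of `φ(r) ^ β ≈ v ^ β` (`exists_lintegral_min_le`). Hence `|I_ρ f|
≤ A N (M / N) ^ β`. Such an `r` may fail to exist only when `v` lies below all dyadic values of `φ`;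
then the first term of the hypothesis suffices.

Since `Ψ(t ^ β) = Φ(t)`, `Ψ⁻¹ = (Φ⁻¹) ^ β` and `η = φ ^ β`, the target norm of `I_ρ f` reduces to a
bound for `M` on the source space. That bound is of weak type for every Young function and of strong
type under `∇₂` (`exists_volume_lt_maximal_le`, `exists_lintegral_maximal_le`). Both split `f` on a
ball into a near part, handled by a modular inequality on the whole space, and a far part whose
averages are at most a multiple of `N φ(r)`.

Necessity tests the operator on the characteristic function of `B(0, 2r)`. Its norm is at most a
multiple of `1 / φ(2r)`, while its potential is at least a multiple of `∫_0^r ρ(t)/t dt` on `B(0,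
r)` (`exists_mul_rhoInt_le`).

For the characterization, (b) and `(*)` give `ρ φ ≤ B η` pointwise, so the extra hypothesis on the
tail restores the full condition of the sufficiency part. -/

namespace OrliczMorrey

/-! ### Young functions and their generalized inverses -/

section Young

variable {Φ : ℝ≥0∞ → ℝ≥0∞}

/-- Convexity along the segment from `0` to `r`, with `Φ 0 = 0`. Almost every constant in the proof
is absorbed through this inequality. -/
lemma IsYoung.map_mul_le (h : IsYoung Φ) {c : ℝ≥0∞} (hc : c ≤ 1) (r : ℝ≥0∞) :
    Φ (c * r) ≤ c * Φ r := by
  lift c to ℝ≥0 using (hc.trans_lt ENNReal.one_lt_top).ne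
  have hc' : c ≤ 1 := by exact_mod_cast hc
  have := h.convex.2 (mem_univ r) (mem_univ 0) (zero_le (a := c)) (zero_le (a := 1 - c))
    (add_tsub_cancel_of_le hc')
  simpa [h.map_zero, ENNReal.smul_def] using this

lemma IsYoung.mono (h : IsYoung Φ) : Monotone Φ := by
  intro r s hrs
  rcases eq_or_ne s ∞ with rfl | hs
  · simp [h.map_top]
  rcases eq_or_ne s 0 with rfl | hs0
  · rw [nonpos_iff_eq_zero.mp hrs]
  have hc : r / s ≤ 1 := ENNReal.div_le_of_le_mul (by simpa using hrs)
  calc Φ r = Φ (r / s * s) := by rw [ENNReal.div_mul_cancel hs0 hs]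
    _ ≤ r / s * Φ s := h.map_mul_le hc s
    _ ≤ 1 * Φ s := by gcongr
    _ = Φ s := one_mul _

lemma IsYoung.map_div_le (h : IsYoung Φ) {c : ℝ≥0∞} (hc : 1 ≤ c) (r : ℝ≥0∞) :
    Φ (r / c) ≤ Φ r / c := by
  rw [div_eq_mul_inv, mul_comm, div_eq_mul_inv, mul_comm (Φ r)]
  exact h.map_mul_le (ENNReal.inv_le_one.2 hc) r

/-- Since `Φ 0 = 0`, the slope `Φ u / u` is nondecreasing. -/
lemma IsYoung.map_mul_le_map_mul (h : IsYoung Φ) {u v : ℝ≥0∞} (huv : u ≤ v) :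
    Φ u * v ≤ Φ v * u := by
  rcases eq_or_ne v ∞ with rfl | hv
  · rcases eq_or_ne u 0 with rfl | hu
    · simp [h.map_zero]
    · simp [h.map_top, ENNReal.top_mul hu]
  rcases eq_or_ne v 0 with rfl | hv0
  · simp
  have hc : u / v ≤ 1 := ENNReal.div_le_of_le_mul (by simpa using huv)
  calc Φ u * v = Φ (u / v * v) * v := by rw [ENNReal.div_mul_cancel hv0 hv]
    _ ≤ u / v * Φ v * v := by gcongr; exact h.map_mul_le hc v
    _ = u / v * v * Φ v := by ring
    _ = Φ v * u := by rw [ENNReal.div_mul_cancel hv0 hv, mul_comm]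

lemma IsYoung.lt_map_of_youngInv_lt (h : IsYoung Φ) {s u : ℝ≥0∞} (hu : youngInv Φ s < u) :
    s < Φ u := by
  obtain ⟨r, hr, hru⟩ := sInf_lt_iff.1 hu
  exact lt_of_lt_of_le hr (h.mono hru.le)

lemma map_le_of_lt_youngInv {s u : ℝ≥0∞} (hu : u < youngInv Φ s) : Φ u ≤ s := by
  by_contra! hc
  exact absurd (sInf_le hc : youngInv Φ s ≤ u) (not_le.2 hu)

lemma le_youngInv_of_map_le (h : Monotone Φ) {s u : ℝ≥0∞} (hu : Φ u ≤ s) : u ≤ youngInv Φ s :=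
  le_sInf fun r hr => by
    by_contra! hc
    exact absurd (h hc.le) (not_le.2 (lt_of_le_of_lt hu hr))

/-- The limit at `0+` rules out a `Φ` that jumps immediately above `s`. -/
lemma IsYoung.youngInv_ne_zero (h : IsYoung Φ) {s : ℝ≥0∞} (hs : s ≠ 0) : youngInv Φ s ≠ 0 := by
  have h1 : ∀ᶠ r in 𝓝[>] (0 : ℝ≥0∞), Φ r < s :=
    h.tendsto_zero.eventually (gt_mem_nhds hs.bot_lt)
  obtain ⟨r, hr, hr0⟩ := (h1.and self_mem_nhdsWithin).exists
  exact (lt_of_lt_of_le hr0 (le_youngInv_of_map_le h.mono hr.le)).ne'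

lemma IsYoung.exists_lt_map (h : IsYoung Φ) {s : ℝ≥0∞} (hs : s ≠ ∞) : ∃ r, r ≠ ∞ ∧ s < Φ r := by
  have h1 : ∀ᶠ r in 𝓝[<] (∞ : ℝ≥0∞), s < Φ r :=
    h.tendsto_top.eventually (lt_mem_nhds hs.lt_top)
  have : (𝓝[<] (∞ : ℝ≥0∞)).NeBot := nhdsLT_neBot_of_exists_lt ⟨0, by simp⟩
  obtain ⟨r, hr, hr0⟩ := (h1.and self_mem_nhdsWithin).exists
  exact ⟨r, hr0.ne, hr⟩

lemma IsYoung.youngInv_ne_top (h : IsYoung Φ) {s : ℝ≥0∞} (hs : s ≠ ∞) : youngInv Φ s ≠ ∞ := by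
  obtain ⟨r, hr, hr'⟩ := h.exists_lt_map hs
  exact ne_top_of_le_ne_top hr (sInf_le hr')

/-- If `s < Φ r`, then `c * s < c * Φ r ≤ Φ (c * r)` by convexity, so `c * r` competes in the
infimum on the left. -/
lemma IsYoung.youngInv_mul_le (h : IsYoung Φ) {c : ℝ≥0∞} (hc : 1 ≤ c) (hc' : c ≠ ∞)
    (s : ℝ≥0∞) : youngInv Φ (c * s) ≤ c * youngInv Φ s := by
  have hc0 : c ≠ 0 := (zero_lt_one.trans_le hc).ne'
  rw [mul_comm c (youngInv Φ s), ← ENNReal.div_le_iff hc0 hc']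
  refine le_sInf fun r hr => ?_
  rw [ENNReal.div_le_iff hc0 hc']
  refine sInf_le ?_
  have h1 := h.map_div_le hc (r * c)
  rw [ENNReal.mul_div_cancel_right hc0 hc', ENNReal.le_div_iff_mul_le (.inl hc0) (.inl hc'),
    mul_comm] at h1
  exact lt_of_lt_of_le (ENNReal.mul_lt_mul_right hc0 hc' hr) h1

/-- A Young function dominates a linear function away from the origin. -/
lemma IsYoung.mul_le (h : IsYoung Φ) {s : ℝ≥0∞} (hs : s ≠ 0) (hs' : s ≠ ∞) (u : ℝ≥0∞) :
    u * s ≤ 2 * youngInv Φ s * (s + Φ u) := by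
  have ha := h.youngInv_ne_zero hs
  have ha' := h.youngInv_ne_top hs'
  rcases le_or_gt u (2 * youngInv Φ s) with hu | hu
  · gcongr
    exact le_self_add
  · have h1 : youngInv Φ s < 2 * youngInv Φ s := by
      rw [two_mul]; exact ENNReal.lt_add_right ha' ha
    calc u * s ≤ u * Φ (2 * youngInv Φ s) := by
          gcongr; exact (h.lt_map_of_youngInv_lt h1).le
      _ ≤ Φ u * (2 * youngInv Φ s) := by
          rw [mul_comm]; exact h.map_mul_le_map_mul hu.le
      _ = 2 * youngInv Φ s * Φ u := mul_comm _ _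
      _ ≤ _ := by gcongr; exact le_add_self

/-- The factor `2` moves the argument strictly below `youngInv Φ s`, where `Φ ≤ s` holds without any
continuity; convexity then extracts `c`. -/
lemma IsYoung.map_div_two_mul_le (h : IsYoung Φ) {s c : ℝ≥0∞} (hs : s ≠ 0) (hs' : s ≠ ∞)
    (hc : 1 ≤ c) : Φ (youngInv Φ s / (2 * c)) ≤ s / c := by
  have ha := h.youngInv_ne_zero hs
  have ha' := h.youngInv_ne_top hs'
  rw [show youngInv Φ s / (2 * c) = youngInv Φ s / 2 / c by
    simp only [div_eq_mul_inv, ENNReal.mul_inv (.inl (two_ne_zero (α := ℝ≥0∞))) (.inl ENNReal.ofNat_ne_top), mul_assoc]]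
  refine (h.map_div_le hc _).trans ?_
  gcongr
  exact map_le_of_lt_youngInv (ENNReal.half_lt_self ha ha')

end Young

/-! ### Luxemburg functionals and the substitution `t ↦ t ^ (1 / β)` -/

section Luxemburg

variable {Φ : ℝ≥0∞ → ℝ≥0∞} {n : ℕ}

lemma luxemburg_le {g : E n → ℝ≥0∞} {l : ℝ≥0∞} (hl : l ≠ 0) (hl' : l ≠ ∞)
    (h : ∫⁻ x, Φ (g x / l) ≤ 1) : luxemburg Φ g ≤ l :=
  sInf_le ⟨hl.bot_lt, hl'.lt_top, h⟩

/-- The strict inequality makes it unnecessary to know that the infimum is attained. -/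
lemma lintegral_le_one_of_luxemburg_lt (hΦ : Monotone Φ) {g : E n → ℝ≥0∞} {l : ℝ≥0∞}
    (h : luxemburg Φ g < l) : ∫⁻ x, Φ (g x / l) ≤ 1 := by
  obtain ⟨r, ⟨-, -, hr⟩, hrl⟩ := sInf_lt_iff.1 h
  refine (lintegral_mono fun x => hΦ ?_).trans hr
  gcongr

lemma luxemburg_mono (hΦ : Monotone Φ) {g g' : E n → ℝ≥0∞} (h : ∀ x, g x ≤ g' x) :
    luxemburg Φ g ≤ luxemburg Φ g' :=
  sInf_le_sInf fun l ⟨h0, h1, h2⟩ => ⟨h0, h1, (lintegral_mono fun x => hΦ (by gcongr; exact h x)).trans h2⟩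

/-- The map `t ↦ t ^ β` is an order isomorphism of `[0,∞]`, so it carries one infimum onto the
other. -/
lemma youngInv_comp_rpow {β : ℝ} (hβ : 0 < β) (s : ℝ≥0∞) :
    youngInv (fun t => Φ (t ^ (1 / β))) s = youngInv Φ s ^ β := by
  apply le_antisymm
  · rw [← ENNReal.rpow_inv_le_iff hβ]
    refine le_sInf fun r hr => ?_
    rw [ENNReal.rpow_inv_le_iff hβ]
    refine sInf_le ?_
    simpa [← ENNReal.rpow_mul, mul_inv_cancel₀ hβ.ne'] using hr
  · refine le_sInf fun r hr => ?_
    rw [← ENNReal.le_rpow_inv_iff hβ]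
    exact sInf_le (by simpa using hr)

lemma invPow_comp_rpow {β : ℝ} (hβ : 0 < β) (r : ℝ) :
    invPow n (fun t => Φ (t ^ (1 / β))) r = invPow n Φ r ^ β :=
  youngInv_comp_rpow hβ _

lemma weakOrliczNorm_le_orliczNorm {𝕜 : Type*} [RCLike 𝕜] (hΦ : Monotone Φ) (f : E n → 𝕜) :
    weakOrliczNorm Φ f ≤ orliczNorm Φ f := by
  refine iSup₂_le fun l _ => luxemburg_mono hΦ fun x => ?_
  exact indicator_apply_le' (fun hx => le_of_lt hx) fun _ => zero_le

lemma weakMorreyNorm_le_morreyNorm {𝕜 : Type*} [RCLike 𝕜] (hΦ : Monotone Φ) (φ : ℝ → ℝ)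
    (f : E n → 𝕜) : weakMorreyNorm Φ φ f ≤ morreyNorm Φ φ f := by
  refine iSup_mono fun x => iSup_mono fun r => iSup_mono fun _ => ?_
  gcongr
  exact weakOrliczNorm_le_orliczNorm hΦ _

end Luxemburg

/-! ### The dyadic maximal function: weak type and modular inequalities -/

section Maximal

variable {n : ℕ}

/-- The centred Hardy-Littlewood maximal function over balls with radii `2 ^ k`, `k ∈ ℤ`. -/
noncomputable def maximal (g : E n → ℝ≥0∞) (x : E n) : ℝ≥0∞ :=
  ⨆ k : ℤ, (∫⁻ y in Metric.ball x ((2 : ℝ) ^ k), g y) / volume (Metric.ball x ((2 : ℝ) ^ k))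

lemma volume_ball_ne_zero (x : E n) {r : ℝ} (hr : 0 < r) : volume (Metric.ball x r) ≠ 0 :=
  (Metric.measure_ball_pos volume x hr).ne'

lemma volume_ball_ne_top (x : E n) (r : ℝ) : volume (Metric.ball x r) ≠ ∞ :=
  measure_ball_lt_top.ne

lemma volume_ball_eq (x : E n) {r : ℝ} (hr : 0 < r) :
    volume (Metric.ball x r) = ENNReal.ofReal (r ^ n) * volume (Metric.ball (0 : E n) 1) := by
  simpa using Measure.addHaar_ball_of_pos volume x hr

lemma volume_ball_mul (x : E n) {c : ℝ} (hc : 0 < c) {r : ℝ} (hr : 0 < r) :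
    volume (Metric.ball x (c * r)) = ENNReal.ofReal (c ^ n) * volume (Metric.ball x r) := by
  rw [volume_ball_eq x (mul_pos hc hr), volume_ball_eq x hr, mul_pow,
    ENNReal.ofReal_mul (by positivity), mul_assoc]

lemma measurable_lintegral_ball {g : E n → ℝ≥0∞} (hg : Measurable g) (r : ℝ) :
    Measurable fun x => ∫⁻ y in Metric.ball x r, g y := by
  have h : (fun x => ∫⁻ y in Metric.ball x r, g y) =
      fun x => ∫⁻ y, {p : E n × E n | dist p.2 p.1 < r}.indicator (fun p => g p.2) (x, y) := by
    funext x
    rw [← lintegral_indicator measurableSet_ball]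
    rfl
  rw [h]
  refine Measurable.lintegral_prod_right' ?_
  exact (hg.comp measurable_snd).indicator
    (measurableSet_lt (measurable_snd.dist measurable_fst) measurable_const)

lemma measurable_maximal {g : E n → ℝ≥0∞} (hg : Measurable g) : Measurable (maximal g) := by
  refine Measurable.iSup fun k => ?_
  have h : ∀ x : E n, volume (Metric.ball x ((2 : ℝ) ^ k))
      = volume (Metric.ball (0 : E n) ((2 : ℝ) ^ k)) := fun x =>
    Measure.addHaar_ball_center volume x _
  simp_rw [h]
  exact (measurable_lintegral_ball hg _).div_const _

lemma laverage_le_maximal (g : E n → ℝ≥0∞) (x : E n) (k : ℤ) :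
    (∫⁻ y in Metric.ball x ((2 : ℝ) ^ k), g y) / volume (Metric.ball x ((2 : ℝ) ^ k)) ≤ maximal g x :=
  le_iSup (fun k : ℤ => (∫⁻ y in Metric.ball x ((2 : ℝ) ^ k), g y) / volume (Metric.ball x ((2 : ℝ) ^ k))) k

lemma maximal_mul_le (g : E n → ℝ≥0∞) {c : ℝ≥0∞} (hc : c ≠ ∞) (x : E n) :
    maximal (fun y => c * g y) x = c * maximal g x := by
  simp_rw [maximal, ENNReal.mul_iSup, lintegral_const_mul' c _ hc, mul_div_assoc]

lemma maximal_le_add_const {g h : E n → ℝ≥0∞} {c : ℝ≥0∞} (hgh : ∀ y, g y ≤ h y + c) (x : E n) :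
    maximal g x ≤ maximal h x + c := by
  refine iSup_le fun k => ?_
  have hr : (0 : ℝ) < 2 ^ k := by positivity
  calc (∫⁻ y in Metric.ball x ((2 : ℝ) ^ k), g y) / volume (Metric.ball x ((2 : ℝ) ^ k))
      ≤ (∫⁻ y in Metric.ball x ((2 : ℝ) ^ k), (h y + c)) / volume (Metric.ball x ((2 : ℝ) ^ k)) := by
        gcongr; exact hgh _
    _ = (∫⁻ y in Metric.ball x ((2 : ℝ) ^ k), h y) / volume (Metric.ball x ((2 : ℝ) ^ k)) + c := by
        rw [lintegral_add_right _ measurable_const,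
          ENNReal.add_div, setLIntegral_const,
          ENNReal.mul_div_cancel_right (volume_ball_ne_zero x hr) (volume_ball_ne_top x _)]
    _ ≤ _ := by gcongr; exact laverage_le_maximal h x k

/-- The weak type (1,1) inequality. -/
lemma volume_lt_maximal_le (hn : n ≠ 0) (g : E n → ℝ≥0∞) {l : ℝ≥0∞} (hl : l ≠ 0) (hl' : l ≠ ∞) :
    volume {x | l < maximal g x} ≤ 4 ^ n / l * ∫⁻ x, g x := by
  rcases eq_or_ne (∫⁻ x, g x) ∞ with hg | hg
  · rw [hg, ENNReal.mul_top]
    · exact le_top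
    · exact (ENNReal.div_pos (by positivity) hl').ne'
  set ω := volume (Metric.ball (0 : E n) 1)
  have hω : ω ≠ 0 := volume_ball_ne_zero _ one_pos
  have hω' : ω ≠ ∞ := volume_ball_ne_top _ _
  let t : Set (E n × ℤ) := {p | l < (∫⁻ y in Metric.ball p.1 ((2 : ℝ) ^ p.2), g y) / volume (Metric.ball p.1 ((2 : ℝ) ^ p.2))}
  have ht : ∀ p ∈ t, volume (Metric.ball p.1 ((2 : ℝ) ^ p.2)) ≤
      l⁻¹ * ∫⁻ y in Metric.ball p.1 ((2 : ℝ) ^ p.2), g y := by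
    intro p hp
    have h1 : l < (∫⁻ y in Metric.ball p.1 ((2 : ℝ) ^ p.2), g y) / volume (Metric.ball p.1 ((2 : ℝ) ^ p.2)) := hp
    rw [ENNReal.lt_div_iff_mul_lt
      (.inl (volume_ball_ne_zero _ (by positivity))) (.inl (volume_ball_ne_top _ _))] at h1
    rw [mul_comm, ← div_eq_mul_inv, ENNReal.le_div_iff_mul_le (.inl hl) (.inl hl'), mul_comm]
    exact h1.le
  -- The Vitali selection needs bounded radii. A radius `r ≥ 1` satisfies `r ≤ r ^ n`, and `r ^ n`
  -- is controlled by the volume bound `ht`.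
  have hR : ∀ p ∈ t, (2 : ℝ) ^ p.2 ≤ max 1 ((l⁻¹ * ∫⁻ y, g y) / ω).toReal := by
    intro p hp
    rcases le_total ((2 : ℝ) ^ p.2) 1 with h1 | h1
    · exact h1.trans (le_max_left _ _)
    · refine (le_self_pow₀ h1 hn).trans (le_trans ?_ (le_max_right _ _))
      rw [← ENNReal.ofReal_le_iff_le_toReal
        (ENNReal.div_ne_top (ENNReal.mul_ne_top (ENNReal.inv_ne_top.2 hl) hg) hω),
        ENNReal.le_div_iff_mul_le (.inl hω) (.inl hω'),
        ← volume_ball_eq p.1 (by positivity)]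
      refine (ht p hp).trans ?_
      gcongr
      exact Measure.restrict_le_self
  -- The enlargement factor `4` is the source of the constant `4 ^ n` in all later weak estimates.
  obtain ⟨u, hut, hdisj, hcov⟩ := Vitali.exists_disjoint_subfamily_covering_enlargement_ball t
    (fun p => p.1) (fun p => (2 : ℝ) ^ p.2) _ hR 4 (by norm_num)
  have hu : u.Countable := hdisj.countable_of_isOpen (fun _ _ => Metric.isOpen_ball)
    fun p _ => Metric.nonempty_ball.2 (by positivity)
  have : Countable u := hu
  have hsub : {x | l < maximal g x} ⊆ ⋃ p : u, Metric.ball p.1.1 (4 * (2 : ℝ) ^ p.1.2) := by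
    intro x hx
    obtain ⟨k, hk⟩ := lt_iSup_iff.1 (show l < maximal g x from hx)
    obtain ⟨b, hb, hxb⟩ := hcov (x, k) hk
    exact mem_iUnion.2 ⟨⟨b, hb⟩, hxb (Metric.mem_ball_self (by positivity))⟩
  calc volume {x | l < maximal g x}
      ≤ ∑' p : u, volume (Metric.ball p.1.1 (4 * (2 : ℝ) ^ p.1.2)) :=
        (measure_mono hsub).trans (measure_iUnion_le _)
    _ ≤ ∑' p : u, 4 ^ n / l * ∫⁻ y in Metric.ball p.1.1 ((2 : ℝ) ^ p.1.2), g y := by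
        refine ENNReal.tsum_le_tsum fun p => ?_
        rw [volume_ball_mul _ (by norm_num) (by positivity), ENNReal.ofReal_pow (by norm_num),
          div_eq_mul_inv, mul_assoc]
        simp only [ENNReal.ofReal_ofNat]
        gcongr
        exact ht _ (hut p.2)
    _ = 4 ^ n / l * ∫⁻ y in ⋃ p : u, Metric.ball p.1.1 ((2 : ℝ) ^ p.1.2), g y := by
        rw [ENNReal.tsum_mul_left, lintegral_iUnion (fun _ => measurableSet_ball)]
        exact hdisj.subtype _ _
    _ ≤ _ := by
        gcongr
        exact Measure.restrict_le_self

/-- The part of `g` not exceeding `l / 2` contributes at most `l / 2` to the maximal function, so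
the part above `l / 2` must account for the other half. -/
lemma volume_lt_maximal_le_trunc (hn : n ≠ 0) {g : E n → ℝ≥0∞} (hg : Measurable g) {l : ℝ≥0∞}
    (hl : l ≠ 0) (hl' : l ≠ ∞) :
    volume {x | l < maximal g x} ≤ 2 * 4 ^ n / l * ∫⁻ x in {x | l / 2 < g x}, g x := by
  have hS : MeasurableSet {x | l / 2 < g x} := measurableSet_lt measurable_const hg
  have h1 : ∀ y, g y ≤ {x | l / 2 < g x}.indicator g y + l / 2 := by
    intro y
    by_cases hy : l / 2 < g y
    · rw [indicator_of_mem (show y ∈ {x | l / 2 < g x} from hy)]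
      exact le_self_add
    · exact (not_lt.1 hy).trans le_add_self
  have h2 : {x | l < maximal g x} ⊆ {x | l / 2 < maximal ({x | l / 2 < g x}.indicator g) x} := by
    intro x hx
    by_contra! hc
    have h3 := maximal_le_add_const h1 x
    have h4 : maximal g x ≤ l / 2 + l / 2 := h3.trans (by gcongr; exact not_lt.1 hc)
    rw [ENNReal.add_halves] at h4
    exact absurd hx (not_lt.2 h4)
  refine (measure_mono h2).trans ((volume_lt_maximal_le hn _ (by simpa using hl)
    (ENNReal.div_ne_top hl' two_ne_zero)).trans ?_)
  rw [lintegral_indicator hS]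
  refine mul_le_mul_left ?_ _
  rw [div_eq_mul_inv, div_eq_mul_inv, div_eq_mul_inv, ENNReal.mul_inv (by simp) (by simp), inv_inv]
  apply le_of_eq
  ring

variable {Φ : ℝ≥0∞ → ℝ≥0∞}

/-- The weak modular inequality for the maximal function. -/
lemma IsYoung.volume_lt_maximal_mul_le (hΦ : IsYoung Φ) (hn : n ≠ 0) {g : E n → ℝ≥0∞}
    (hg : Measurable g) (l : ℝ≥0∞) :
    volume {x | l < maximal g x} * Φ (l / 2) ≤ 4 ^ n * ∫⁻ x, Φ (g x) := by
  rcases eq_or_ne l 0 with rfl | hl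
  · simp [hΦ.map_zero]
  rcases eq_or_ne l ∞ with rfl | hl'
  · simp
  calc volume {x | l < maximal g x} * Φ (l / 2)
      ≤ 2 * 4 ^ n / l * (∫⁻ x in {x | l / 2 < g x}, g x) * Φ (l / 2) := by
        gcongr; exact volume_lt_maximal_le_trunc hn hg hl hl'
    _ = 2 * 4 ^ n / l * ∫⁻ x in {x | l / 2 < g x}, Φ (l / 2) * g x := by
        rw [lintegral_const_mul _ hg]; ring
    _ ≤ 2 * 4 ^ n / l * ∫⁻ x in {x | l / 2 < g x}, l / 2 * Φ (g x) := by
        gcongr 2 * 4 ^ n / l * ?_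
        refine setLIntegral_mono' (measurableSet_lt measurable_const hg) fun x hx => ?_
        rw [mul_comm (l / 2)]
        exact hΦ.map_mul_le_map_mul (le_of_lt hx)
    _ ≤ 2 * 4 ^ n / l * ∫⁻ x, l / 2 * Φ (g x) := by
        gcongr; exact Measure.restrict_le_self
    _ = 4 ^ n * ∫⁻ x, Φ (g x) := by
        rw [lintegral_const_mul _ (show Measurable fun x => Φ (g x) from hΦ.mono.measurable.comp hg), ← mul_assoc]
        congr 1
        calc 2 * 4 ^ n / l * (l / 2) = 4 ^ n * (2 * 2⁻¹) * (l * l⁻¹) := by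
              simp only [div_eq_mul_inv]; ring
          _ = 4 ^ n := by
              rw [ENNReal.mul_inv_cancel hl hl', ENNReal.mul_inv_cancel (by simp) (by simp)]; simp

/-- A discrete layer-cake bound: for `C ^ j < v ≤ C ^ (j + 1)` the single term of index `j`
suffices. -/
lemma IsYoung.le_tsum_dyadic (hΦ : IsYoung Φ) {C : ℝ≥0∞} (hC : 1 < C) (hC' : C ≠ ∞) (v : ℝ≥0∞) :
    Φ v ≤ ∑' j : ℤ, Φ (C ^ (j + 1)) * {w | C ^ j < w}.indicator 1 v := by
  have key : ∀ j : ℤ, C ^ j < v →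
      Φ (C ^ (j + 1)) ≤ ∑' j : ℤ, Φ (C ^ (j + 1)) * {w | C ^ j < w}.indicator 1 v := by
    intro j hj
    refine le_trans ?_ (ENNReal.le_tsum j)
    rw [indicator_of_mem (show v ∈ {w | C ^ j < w} from hj)]
    simp
  rcases eq_or_ne v 0 with rfl | hv
  · simp [hΦ.map_zero]
  rcases eq_or_ne v ∞ with rfl | hv'
  · refine le_of_forall_lt fun s hs => ?_
    obtain ⟨r, hr, hsr⟩ := hΦ.exists_lt_map hs.ne_top
    have hm : max r 1 ≠ ∞ := by simp [hr]
    obtain ⟨j, hj⟩ := ENNReal.exists_mem_Ioc_zpow (x := max r 1) (by simp) hm hC hC'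
    refine hsr.trans_le ((hΦ.mono ((le_max_left r 1).trans hj.2)).trans (key j ?_))
    exact lt_top_iff_ne_top.2 (hj.1.trans_le le_top).ne
  · obtain ⟨j, hj⟩ := ENNReal.exists_mem_Ioc_zpow hv hv' hC hC'
    exact (hΦ.mono hj.2).trans (key j hj.1)

/-- Under the `∇₂` condition `∑ Φ (C ^ (j + 1)) / C ^ j` behaves like a geometric series. -/
lemma IsYoung.mul_tsum_le (hΦ : IsYoung Φ) {C : ℝ≥0∞} (hC : 1 < C) (hC' : C ≠ ∞)
    (hN : ∀ r, r ≠ ∞ → Φ r ≤ Φ (C * r) / (2 * C)) {u : ℝ≥0∞} (hu' : u ≠ ∞) :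
    ∑' j : ℤ, Φ (C ^ (j + 1)) / C ^ j * {w | C ^ j < 2 * w}.indicator (fun w => w) u
      ≤ Φ (2 * C * u) := by
  have hC0 : C ≠ 0 := (zero_lt_one.trans hC).ne'
  rcases eq_or_ne u 0 with rfl | hu
  · simp
  -- `J` is the last index with a nonzero term. The `∇₂` condition says `a j ≤ a (j + 1) / 2`, so
  -- the sum going down from `J` is at most `2 * a J * u`.
  obtain ⟨J, hJ1, hJ2⟩ := ENNReal.exists_mem_Ioc_zpow (x := 2 * u) (by simpa using hu)
    (ENNReal.mul_ne_top (by simp) hu') hC hC'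
  have hz : ∀ j : ℤ, C ^ j ≠ 0 := fun j => (ENNReal.zpow_pos hC0 hC' j).ne'
  have hz' : ∀ j : ℤ, C ^ j ≠ ∞ := fun j => (ENNReal.zpow_lt_top hC0 hC' j).ne
  set a : ℤ → ℝ≥0∞ := fun j => Φ (C ^ (j + 1)) / C ^ j with ha
  have hstep : ∀ j, a j ≤ 2⁻¹ * a (j + 1) := by
    intro j
    have h1 := hN (C ^ (j + 1)) (hz' _)
    have h2 : C * C ^ (j + 1) = C ^ (j + 1 + 1) := by
      rw [ENNReal.zpow_add hC0 hC' (j + 1) 1, zpow_one, mul_comm]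
    rw [h2] at h1
    calc a j ≤ Φ (C ^ (j + 1 + 1)) / (2 * C) / C ^ j := by simp only [ha]; gcongr
      _ = 2⁻¹ * (Φ (C ^ (j + 1 + 1)) / (C ^ j * C)) := by
        simp only [div_eq_mul_inv]
        rw [ENNReal.mul_inv (.inl two_ne_zero) (.inl ENNReal.ofNat_ne_top),
          ENNReal.mul_inv (.inl (hz j)) (.inl (hz' j))]
        ring
      _ = 2⁻¹ * a (j + 1) := by
        simp only [ha]; rw [ENNReal.zpow_add hC0 hC' j 1, zpow_one]
  have hgeo : ∀ i : ℕ, a (J - i) ≤ 2⁻¹ ^ i * a J := by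
    intro i
    induction i with
    | zero => simp
    | succ i ih =>
      have h1 := hstep (J - (i + 1 : ℕ))
      have h2 : J - ((i + 1 : ℕ) : ℤ) + 1 = J - i := by push_cast; ring
      rw [h2] at h1
      refine h1.trans ?_
      rw [pow_succ', mul_assoc]
      gcongr
  have hinj : Function.Injective fun i : ℕ => J - (i : ℤ) := fun i j h => by
    simp only at h; omega
  rw [← hinj.tsum_eq]
  · calc ∑' i : ℕ, Φ (C ^ (J - (i : ℤ) + 1)) / C ^ (J - (i : ℤ)) *
          {w | C ^ (J - (i : ℤ)) < 2 * w}.indicator (fun w => w) u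
        ≤ ∑' i : ℕ, 2⁻¹ ^ i * (a J * u) := by
          refine ENNReal.tsum_le_tsum fun i => ?_
          rw [← mul_assoc]
          exact mul_le_mul' (hgeo i) (indicator_le_self _ _ _)
      _ = 2 * (a J * u) := by
          rw [ENNReal.tsum_mul_right, ENNReal.tsum_geometric, ENNReal.one_sub_inv_two, inv_inv]
      _ ≤ Φ (2 * C * u) := by
          -- Monotonicity of the slope between these two points absorbs the factor `2` of the
          -- geometric series.
          have h1 : C ^ (J + 1) ≤ 2 * C * u := by
            rw [ENNReal.zpow_add hC0 hC', zpow_one, mul_comm, mul_comm 2, mul_assoc]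
            gcongr
          have h2 := hΦ.map_mul_le_map_mul h1
          rw [ENNReal.zpow_add hC0 hC' J 1, zpow_one] at h2
          simp only [ha]
          rw [ENNReal.zpow_add hC0 hC' J 1, zpow_one]
          have h3 : Φ (C ^ J * C) * (2 * u) ≤ Φ (2 * C * u) * C ^ J := by
            rw [← ENNReal.mul_le_mul_iff_left hC0 hC']
            calc Φ (C ^ J * C) * (2 * u) * C = Φ (C ^ J * C) * (2 * C * u) := by ring
              _ ≤ _ := h2
              _ = _ := by ring
          calc 2 * (Φ (C ^ J * C) / C ^ J * u) = Φ (C ^ J * C) * (2 * u) / C ^ J := by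
                simp only [div_eq_mul_inv]; ring
            _ ≤ _ := ENNReal.div_le_of_le_mul h3
  · intro j hj
    have hj' : C ^ j < 2 * u := by
      by_contra hc
      exact hj (by simp only [indicator_of_notMem (show u ∉ {w | C ^ j < 2 * w} from hc), mul_zero])
    have h4 : j < J + 1 := by
      by_contra! hc
      exact absurd (hj'.trans_le hJ2) (not_lt.2 (ENNReal.zpow_le_of_le hC.le hc))
    exact ⟨(J - j).toNat, by simp only; omega⟩

/-- The strong modular inequality for the maximal function under the `∇₂` condition. -/
lemma IsYoung.lintegral_maximal_le (hΦ : IsYoung Φ) (hn : n ≠ 0) {C : ℝ≥0∞} (hC : 1 < C)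
    (hC' : C ≠ ∞) (hN : ∀ r, r ≠ ∞ → Φ r ≤ Φ (C * r) / (2 * C)) {g : E n → ℝ≥0∞}
    (hg : Measurable g) (hg' : ∀ x, g x ≠ ∞) :
    ∫⁻ x, Φ (maximal g x) ≤ 2 * 4 ^ n * ∫⁻ x, Φ (2 * C * g x) := by
  have hC0 : C ≠ 0 := (zero_lt_one.trans hC).ne'
  have hz : ∀ j : ℤ, C ^ j ≠ 0 := fun j => (ENNReal.zpow_pos hC0 hC' j).ne'
  have hz' : ∀ j : ℤ, C ^ j ≠ ∞ := fun j => (ENNReal.zpow_lt_top hC0 hC' j).ne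
  have hS : ∀ j : ℤ, MeasurableSet {x | C ^ j < 2 * g x} := fun j =>
    measurableSet_lt measurable_const (hg.const_mul 2)
  have hT : ∀ j : ℤ, MeasurableSet {w : ℝ≥0∞ | C ^ j < w} := fun j => measurableSet_Ioi
  have hI : ∀ j : ℤ, Measurable fun x => {w | C ^ j < w}.indicator (1 : ℝ≥0∞ → ℝ≥0∞) (maximal g x) :=
    fun j => (measurable_one.indicator (hT j)).comp (measurable_maximal hg)
  have hI' : ∀ j : ℤ, Measurable fun x => {w | C ^ j < 2 * w}.indicator (fun w => w) (g x) :=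
    fun j => hg.indicator (hS j)
  calc ∫⁻ x, Φ (maximal g x)
      ≤ ∫⁻ x, ∑' j : ℤ, Φ (C ^ (j + 1)) * {w | C ^ j < w}.indicator 1 (maximal g x) :=
        lintegral_mono fun x => hΦ.le_tsum_dyadic hC hC' _
    _ = ∑' j : ℤ, Φ (C ^ (j + 1)) * volume {x | C ^ j < maximal g x} := by
        rw [lintegral_tsum fun j => ((hI j).const_mul _).aemeasurable]
        congr with j
        rw [lintegral_const_mul _ (hI j)]
        congr 1
        exact lintegral_indicator_one (measurable_maximal hg (hT j))
    _ ≤ ∑' j : ℤ, Φ (C ^ (j + 1)) * (2 * 4 ^ n / C ^ j * ∫⁻ x in {x | C ^ j < 2 * g x}, g x) := by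
        refine ENNReal.tsum_le_tsum fun j => ?_
        gcongr
        refine (volume_lt_maximal_le_trunc hn hg (hz j) (hz' j)).trans_eq ?_
        congr 3
        ext x
        simp only [mem_ofPred_eq]
        rw [ENNReal.div_lt_iff (by simp) (by simp), mul_comm]
    _ = 2 * 4 ^ n * ∑' j : ℤ, ∫⁻ x, Φ (C ^ (j + 1)) / C ^ j *
          {w | C ^ j < 2 * w}.indicator (fun w => w) (g x) := by
        rw [← ENNReal.tsum_mul_left]
        congr with j
        have h1 : (fun x => {w | C ^ j < 2 * w}.indicator (fun w => w) (g x)) =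
            {x | C ^ j < 2 * g x}.indicator g := rfl
        rw [lintegral_const_mul _ (hI' j), h1, lintegral_indicator (hS j)]
        simp only [div_eq_mul_inv]
        ring
    _ = 2 * 4 ^ n * ∫⁻ x, ∑' j : ℤ, Φ (C ^ (j + 1)) / C ^ j *
          {w | C ^ j < 2 * w}.indicator (fun w => w) (g x) := by
        rw [lintegral_tsum fun j => ((hI' j).const_mul _).aemeasurable]
    _ ≤ _ := by
        gcongr with x
        exact hΦ.mul_tsum_le hC hC' hN (hg' x)

end Maximal

/-! ### Doubling properties of `φ` and of `φ(r) / Φ⁻¹(r^{-n})` -/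

section Scale

variable {n : ℕ} {Φ : ℝ≥0∞ → ℝ≥0∞} {φ : ℝ → ℝ}

lemma ennreal_div_mul {a b c : ℝ≥0∞} (hb : b ≠ 0) (hb' : b ≠ ∞) : a / (b * c) = a / b / c := by
  simp only [div_eq_mul_inv, ENNReal.mul_inv (.inl hb) (.inl hb'), mul_assoc]

lemma ofReal_inv_pow_ne_zero (n : ℕ) {r : ℝ} (hr : 0 < r) : ENNReal.ofReal (r ^ n)⁻¹ ≠ 0 := by
  simpa using pow_pos hr n

lemma ofReal_inv_pow_mul_volume_ball (x : E n) {r : ℝ} (hr : 0 < r) :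
    ENNReal.ofReal (r ^ n)⁻¹ * volume (Metric.ball x r) = volume (Metric.ball (0 : E n) 1) := by
  rw [volume_ball_eq x hr, ← mul_assoc, ← ENNReal.ofReal_mul (by positivity),
    inv_mul_cancel₀ (by positivity), ENNReal.ofReal_one, one_mul]

lemma IsYoung.invPow_ne_zero (hΦ : IsYoung Φ) {r : ℝ} (hr : 0 < r) : invPow n Φ r ≠ 0 :=
  hΦ.youngInv_ne_zero (ofReal_inv_pow_ne_zero n hr)

lemma IsYoung.invPow_ne_top (hΦ : IsYoung Φ) (r : ℝ) : invPow n Φ r ≠ ∞ :=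
  hΦ.youngInv_ne_top ENNReal.ofReal_ne_top

/-- Concavity of `Φ⁻¹` in disguise: `r ↦ Φ⁻¹(r^{-n})` decays no faster than `r^{-n}`. -/
lemma IsYoung.invPow_le_mul (hΦ : IsYoung Φ) {s t : ℝ} (hs : 0 < s) (hst : s ≤ t) :
    invPow n Φ s ≤ ENNReal.ofReal ((t / s) ^ n) * invPow n Φ t := by
  have ht := hs.trans_le hst
  have h1 : (1 : ℝ) ≤ (t / s) ^ n := one_le_pow₀ ((one_le_div hs).2 hst)
  have h2 : ENNReal.ofReal (s ^ n)⁻¹ =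
      ENNReal.ofReal ((t / s) ^ n) * ENNReal.ofReal (t ^ n)⁻¹ := by
    rw [← ENNReal.ofReal_mul (by positivity)]
    congr 1
    rw [div_pow]
    field_simp
  rw [invPow, h2]
  exact hΦ.youngInv_mul_le (by simpa using h1) ENNReal.ofReal_ne_top _

/-- `φ(r) / Φ⁻¹(r^{-n})`, up to constants the largest `L^Φ` norm on a ball of radius `r` of a
function with Orlicz-Morrey norm one. -/
noncomputable def scale (n : ℕ) (Φ : ℝ≥0∞ → ℝ≥0∞) (φ : ℝ → ℝ) (r : ℝ) : ℝ≥0∞ :=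
  ENNReal.ofReal (φ r) / invPow n Φ r

lemma MemG.scale_ne_zero (hΦ : IsYoung Φ) (hφ : MemG n Φ φ) {r : ℝ} (hr : 0 < r) :
    scale n Φ φ r ≠ 0 :=
  (ENNReal.div_pos (by simpa using hφ.pos r hr) (hΦ.invPow_ne_top r)).ne'

lemma scale_ne_top (hΦ : IsYoung Φ) {r : ℝ} (hr : 0 < r) : scale n Φ φ r ≠ ∞ :=
  ENNReal.div_ne_top ENNReal.ofReal_ne_top (hΦ.invPow_ne_zero hr)

lemma scale_mul_invPow (hΦ : IsYoung Φ) {r : ℝ} (hr : 0 < r) :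
    scale n Φ φ r * invPow n Φ r = ENNReal.ofReal (φ r) :=
  ENNReal.div_mul_cancel (hΦ.invPow_ne_zero hr) (hΦ.invPow_ne_top r)

lemma MemG.exists_scale_le (hΦ : IsYoung Φ) (hφ : MemG n Φ φ) :
    ∃ D : ℝ≥0∞, D ≠ ∞ ∧ ∀ s t, 0 < s → s ≤ t → scale n Φ φ s ≤ D * scale n Φ φ t := by
  obtain ⟨C, hC, h⟩ := hφ.inc
  refine ⟨ENNReal.ofReal C, ENNReal.ofReal_ne_top, fun s t hs hst => ?_⟩
  have key : ∀ r, 0 < r →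
      ENNReal.ofReal (φ r / (invPow n Φ r).toReal) = scale n Φ φ r := fun r hr => by
    rw [ENNReal.ofReal_div_of_pos (ENNReal.toReal_pos (hΦ.invPow_ne_zero hr) (hΦ.invPow_ne_top r)),
      ENNReal.ofReal_toReal (hΦ.invPow_ne_top r), scale]
  rw [← key s hs, ← key t (hs.trans_le hst), ← ENNReal.ofReal_mul hC.le]
  exact ENNReal.ofReal_le_ofReal (h s t hs hst)

/-- A function in `𝒢_Φ` that is almost decreasing satisfies a doubling condition. -/
lemma MemG.exists_le_mul (hΦ : IsYoung Φ) (hφ : MemG n Φ φ) (hdec : AlmostDecreasing φ) (K : ℝ) :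
    ∃ D : ℝ≥0∞, 1 ≤ D ∧ D ≠ ∞ ∧ ∀ s t, 0 < s → 0 < t → t ≤ K * s →
      ENNReal.ofReal (φ s) ≤ D * ENNReal.ofReal (φ t) := by
  obtain ⟨C, hC, h⟩ := hdec
  obtain ⟨D, hD, h'⟩ := hφ.exists_scale_le hΦ
  refine ⟨1 + ENNReal.ofReal C⁻¹ + D * ENNReal.ofReal (K ^ n), ?_, ?_, fun s t hs ht hst => ?_⟩
  · rw [add_assoc]; exact le_self_add
  · exact ENNReal.add_ne_top.2 ⟨by simp, ENNReal.mul_ne_top hD ENNReal.ofReal_ne_top⟩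
  -- For `t ≤ s` this is almost decrease. For `s ≤ t ≤ K * s`, write `φ` as `scale` times `invPow`:
  -- the first factor is almost increasing and the second loses at most `K ^ n`.
  rcases le_total t s with hts | hts
  · have h1 : φ s ≤ C⁻¹ * φ t := by
      rw [inv_mul_eq_div, le_div_iff₀ hC, mul_comm]
      exact h t s ht hts
    calc ENNReal.ofReal (φ s) ≤ ENNReal.ofReal C⁻¹ * ENNReal.ofReal (φ t) := by
          rw [← ENNReal.ofReal_mul (by positivity)]; exact ENNReal.ofReal_le_ofReal h1
      _ ≤ _ := by
          gcongr
          exact le_add_right le_add_self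
  · calc ENNReal.ofReal (φ s) = scale n Φ φ s * invPow n Φ s := (scale_mul_invPow hΦ hs).symm
      _ ≤ D * scale n Φ φ t * (ENNReal.ofReal ((t / s) ^ n) * invPow n Φ t) := by
          gcongr
          · exact h' s t hs hts
          · exact hΦ.invPow_le_mul hs hts
      _ = D * ENNReal.ofReal ((t / s) ^ n) * (scale n Φ φ t * invPow n Φ t) := by ring
      _ ≤ D * ENNReal.ofReal (K ^ n) * ENNReal.ofReal (φ t) := by
          rw [scale_mul_invPow hΦ ht]
          gcongr
          exact div_le_of_le_mul₀ hs.le (by nlinarith) hst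
      _ ≤ _ := by
          gcongr
          exact le_add_self

lemma MemG.exists_scale_two_mul_le (hΦ : IsYoung Φ) (hφ : MemG n Φ φ) (hdec : AlmostDecreasing φ) :
    ∃ D : ℝ≥0∞, 1 ≤ D ∧ D ≠ ∞ ∧ ∀ r, 0 < r → scale n Φ φ (2 * r) ≤ D * scale n Φ φ r := by
  obtain ⟨D, hD1, hD, h⟩ := hφ.exists_le_mul hΦ hdec 1
  refine ⟨D * 2 ^ n, ?_, ENNReal.mul_ne_top hD (by simp), fun r hr => ?_⟩
  · exact one_le_mul hD1 (one_le_pow₀ one_le_two)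
  have h1 := hΦ.invPow_le_mul (n := n) hr (show r ≤ 2 * r by linarith)
  rw [mul_div_cancel_right₀ _ hr.ne', ENNReal.ofReal_pow (by norm_num), ENNReal.ofReal_ofNat] at h1
  refine ENNReal.div_le_of_le_mul ?_
  calc ENNReal.ofReal (φ (2 * r)) ≤ D * ENNReal.ofReal (φ r) :=
        h _ _ (by positivity) hr (by linarith)
    _ = D * (scale n Φ φ r * invPow n Φ r) := by rw [scale_mul_invPow hΦ hr]
    _ ≤ D * (scale n Φ φ r * (2 ^ n * invPow n Φ (2 * r))) := by gcongr
    _ = _ := by ring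

end Scale

/-! ### The maximal operator on Orlicz-Morrey spaces -/

section MorreyMaximal

variable {n : ℕ} {Φ : ℝ≥0∞ → ℝ≥0∞} {φ : ℝ → ℝ}

/-- The modular form of the assertion that the Orlicz-Morrey norm of `g` is at most `N`. -/
def MorreyBound (Φ : ℝ≥0∞ → ℝ≥0∞) (φ : ℝ → ℝ) (N : ℝ≥0∞) (g : E n → ℝ≥0∞) : Prop :=
  ∀ (x : E n) (r : ℝ), 0 < r →
    ∫⁻ y in Metric.ball x r, Φ (g y / (N * scale n Φ φ r)) ≤ 1

lemma morreyBound_of_morreyNorm_lt {𝕜 : Type*} [RCLike 𝕜] (hΦ : IsYoung Φ) (hφ : MemG n Φ φ)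
    {f : E n → 𝕜} {N : ℝ≥0∞} (hN : morreyNorm Φ φ f < N) :
    MorreyBound Φ φ N fun x => ‖f x‖ₑ := by
  intro x r hr
  have h1 : (ENNReal.ofReal (φ r))⁻¹ * invPow n Φ r *
      orliczNorm Φ ((Metric.ball x r).indicator f) < N :=
    
    lt_of_le_of_lt (le_iSup_of_le x (le_iSup₂ (f := fun (r : ℝ) (_ : 0 < r) =>
      (ENNReal.ofReal (φ r))⁻¹ * invPow n Φ r *
        orliczNorm Φ ((Metric.ball x r).indicator f)) r hr)) hN
  have hφr : ENNReal.ofReal (φ r) ≠ 0 := by simpa using hφ.pos r hr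
  have h2 : orliczNorm Φ ((Metric.ball x r).indicator f) < N * scale n Φ φ r := by
    have h3 : (ENNReal.ofReal (φ r))⁻¹ * invPow n Φ r = (scale n Φ φ r)⁻¹ := by
      rw [scale, ENNReal.inv_div (.inl (hΦ.invPow_ne_top r)) (.inl (hΦ.invPow_ne_zero hr)),
        div_eq_mul_inv, mul_comm]
    rwa [h3, mul_comm, ← div_eq_mul_inv, ENNReal.div_lt_iff (.inl (hφ.scale_ne_zero hΦ hr))
      (.inl (scale_ne_top hΦ hr))] at h1
  refine le_trans ?_ (lintegral_le_one_of_luxemburg_lt hΦ.mono h2)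
  rw [← lintegral_indicator measurableSet_ball]
  refine lintegral_mono fun y => ?_
  by_cases hy : y ∈ Metric.ball x r
  · simp [indicator_of_mem hy]
  · simp [indicator_of_notMem hy]

lemma MorreyBound.congr {N : ℝ≥0∞} {g g' : E n → ℝ≥0∞} (h : MorreyBound Φ φ N g)
    (hg : g =ᵐ[volume] g') : MorreyBound Φ φ N g' := fun x r hr => by
  refine (lintegral_congr_ae ?_).trans_le (h x r hr)
  filter_upwards [ae_restrict_of_ae hg] with y hy
  rw [hy]

/-- Averages over a ball of radius `r` are controlled by `φ r`. -/
lemma exists_lintegral_ball_le (n : ℕ) (hΦ : IsYoung Φ) (φ : ℝ → ℝ) (hpos : ∀ t, 0 < t → 0 < φ t) :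
    ∃ A : ℝ≥0∞, A ≠ ∞ ∧ ∀ (N : ℝ≥0∞) (g : E n → ℝ≥0∞), N ≠ 0 → N ≠ ∞ → Measurable g →
      MorreyBound Φ φ N g → ∀ (x : E n) (r : ℝ), 0 < r →
        (∫⁻ y in Metric.ball x r, g y) ≤
          A * N * ENNReal.ofReal (φ r) * volume (Metric.ball x r) := by
  set ω := volume (Metric.ball (0 : E n) 1)
  have hω : ω ≠ 0 := volume_ball_ne_zero _ one_pos
  have hω' : ω ≠ ∞ := volume_ball_ne_top _ _
  refine ⟨2 * (1 + ω⁻¹), ENNReal.mul_ne_top (by simp) (by simp [hω]), ?_⟩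
  intro N g hN hN' hg h x r hr
  set s := ENNReal.ofReal (r ^ n)⁻¹
  have hs : s ≠ 0 := ofReal_inv_pow_ne_zero n hr
  have hs' : s ≠ ∞ := ENNReal.ofReal_ne_top
  set B := Metric.ball x r
  have hsB : s * volume B = ω := ofReal_inv_pow_mul_volume_ball x hr
  have hS : scale n Φ φ r ≠ 0 :=
    (ENNReal.div_pos (by simpa using hpos r hr) (hΦ.invPow_ne_top r)).ne'
  set T := N * scale n Φ φ r
  have hT : T ≠ 0 := mul_ne_zero hN hS
  have hT' : T ≠ ∞ := ENNReal.mul_ne_top hN' (scale_ne_top hΦ hr)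
  set a := invPow n Φ r
  have hTa : T * a = N * ENNReal.ofReal (φ r) := by
    rw [mul_assoc, scale_mul_invPow hΦ hr]
  -- A substitute for Hölder's inequality in Orlicz spaces: integrate `IsYoung.mul_le` with `u = g /
  -- T` and `s = r^{-n}`. Since `s * volume B = ω`, both resulting terms are bounded independently
  -- of `r`.
  have h1 : (∫⁻ y in B, g y) * s ≤ T * (2 * a * (ω + 1)) := by
    calc (∫⁻ y in B, g y) * s = T * ∫⁻ y in B, g y / T * s := by
          rw [← lintegral_const_mul' _ _ hT', ← lintegral_mul_const' _ _ hs']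
          congr with y
          rw [← mul_assoc, ENNReal.mul_div_cancel hT hT']
      _ ≤ T * ∫⁻ y in B, 2 * a * (s + Φ (g y / T)) := by
          refine mul_le_mul_right (lintegral_mono fun y => ?_) _
          exact hΦ.mul_le hs hs' _
      _ = T * (2 * a * (s * volume B + ∫⁻ y in B, Φ (g y / T))) := by
          rw [lintegral_const_mul' _ _ (ENNReal.mul_ne_top (by simp) (hΦ.invPow_ne_top r)),
            lintegral_add_left measurable_const, setLIntegral_const]
      _ ≤ _ := by
          rw [hsB]
          gcongr
          exact h x r hr
  rw [← ENNReal.mul_le_mul_iff_left hs hs']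
  refine h1.trans_eq ?_
  calc T * (2 * a * (ω + 1)) = T * a * (2 * (ω + 1)) := by ring
    _ = T * a * (2 * (ω + ω⁻¹ * ω)) := by rw [ENNReal.inv_mul_cancel hω hω']
    _ = 2 * (1 + ω⁻¹) * (T * a) * ω := by ring
    _ = _ := by rw [hTa, ← hsB]; ring

/-- On a ball, the maximal function of `g` is that of the local part of `g` up to a constant. -/
lemma exists_maximal_le_add (hΦ : IsYoung Φ) (hφ : MemG n Φ φ) (hdec : AlmostDecreasing φ) :
    ∃ A : ℝ≥0∞, A ≠ ∞ ∧ ∀ (N : ℝ≥0∞) (g : E n → ℝ≥0∞), N ≠ 0 → N ≠ ∞ → Measurable g →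
      MorreyBound Φ φ N g → ∀ (x₀ : E n) (r : ℝ), 0 < r → ∀ x ∈ Metric.ball x₀ r,
        maximal g x ≤ maximal ((Metric.ball x₀ (2 * r)).indicator g) x
          + A * N * ENNReal.ofReal (φ r) := by
  obtain ⟨A, hA, h⟩ := exists_lintegral_ball_le n hΦ φ hφ.pos
  obtain ⟨D, -, hD, hD'⟩ := hφ.exists_le_mul hΦ hdec 1
  refine ⟨A * D, ENNReal.mul_ne_top hA hD, fun N g hN hN' hg hgN x₀ r hr x hx => ?_⟩
  refine iSup_le fun k => ?_
  have hk : (0 : ℝ) < 2 ^ k := by positivity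
  -- Balls of radius at most `r` stay inside `B(x₀, 2r)`; averages over larger balls are controlled
  -- by `φ(2 ^ k)`, hence by `φ r`.
  rcases le_or_gt ((2 : ℝ) ^ k) r with hkr | hkr
  · refine le_trans ?_ le_self_add
    refine le_trans (le_of_eq ?_) (laverage_le_maximal _ x k)
    congr 1
    refine setLIntegral_congr_fun measurableSet_ball fun y hy => ?_
    rw [indicator_of_mem]
    rw [Metric.mem_ball] at *
    linarith [dist_triangle y x x₀]
  · refine le_trans ?_ le_add_self
    rw [ENNReal.div_le_iff (volume_ball_ne_zero x hk) (volume_ball_ne_top x _)]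
    refine (h N g hN hN' hg hgN x _ hk).trans ?_
    gcongr ?_ * _
    calc A * N * ENNReal.ofReal (φ (2 ^ k)) ≤ A * N * (D * ENNReal.ofReal (φ r)) := by
          gcongr; exact hD' _ _ hk hr (by linarith)
      _ = _ := by ring

/-- Doubling of `scale` lets the modular bound on `B(x, 2r)` be normalized by the scale of `r`, so
the near part can be fed to inequalities on the whole space. -/
lemma MorreyBound.lintegral_indicator_le (hΦ : IsYoung Φ) {D N : ℝ≥0∞}
    (hD : ∀ r, 0 < r → scale n Φ φ (2 * r) ≤ D * scale n Φ φ r) {g : E n → ℝ≥0∞}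
    (hg : MorreyBound Φ φ N g) (x : E n) {r : ℝ} (hr : 0 < r) :
    ∫⁻ y, Φ ((D * (N * scale n Φ φ r))⁻¹ * (Metric.ball x (2 * r)).indicator g y) ≤ 1 := by
  refine le_trans ?_ (hg x (2 * r) (by positivity))
  rw [← lintegral_indicator measurableSet_ball]
  refine lintegral_mono fun y => ?_
  by_cases hy : y ∈ Metric.ball x (2 * r)
  · simp only [indicator_of_mem hy]
    refine hΦ.mono ?_
    rw [← ENNReal.div_eq_inv_mul]
    gcongr g y / ?_
    calc N * scale n Φ φ (2 * r) ≤ N * (D * scale n Φ φ r) := by gcongr; exact hD r hr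
      _ = _ := by ring
  · simp [indicator_of_notMem hy, hΦ.map_zero]

/-- The value of `Φ` at a small multiple of `Φ⁻¹(r^{-n})` is small compared with `|B(x, r)|⁻¹`. -/
lemma IsYoung.volume_ball_mul_le (hΦ : IsYoung Φ) (x : E n) {r : ℝ} (hr : 0 < r) {c ε : ℝ≥0∞}
    (hε : ε ≠ 0) (hε' : ε ≤ 1)
    (hc : c ≤ invPow n Φ r / (2 * ((1 + volume (Metric.ball (0 : E n) 1)) / ε))) :
    volume (Metric.ball x r) * Φ c ≤ ε := by
  set ω := volume (Metric.ball (0 : E n) 1)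
  have hω' : ω ≠ ∞ := volume_ball_ne_top _ _
  have hε1 : ε ≠ ∞ := ne_top_of_le_ne_top ENNReal.one_ne_top hε'
  have hK : 1 ≤ (1 + ω) / ε := by
    rw [ENNReal.le_div_iff_mul_le (.inl hε) (.inl hε1), one_mul]
    exact hε'.trans le_self_add
  calc volume (Metric.ball x r) * Φ c
      ≤ volume (Metric.ball x r) * (ENNReal.ofReal (r ^ n)⁻¹ / ((1 + ω) / ε)) := by
        gcongr
        exact (hΦ.mono hc).trans (hΦ.map_div_two_mul_le (ofReal_inv_pow_ne_zero n hr)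
          ENNReal.ofReal_ne_top hK)
    _ = ω / ((1 + ω) / ε) := by
        rw [← mul_div_assoc, mul_comm, ofReal_inv_pow_mul_volume_ball x hr]
    _ ≤ ε := by
        refine ENNReal.div_le_of_le_mul ?_
        rw [ENNReal.mul_div_cancel hε hε1]
        exact le_add_self

/-- The maximal operator is of weak type on Orlicz-Morrey spaces. -/
lemma exists_volume_lt_maximal_le (hn : n ≠ 0) (hΦ : IsYoung Φ) (hφ : MemG n Φ φ)
    (hdec : AlmostDecreasing φ) :
    ∃ A : ℝ≥0∞, A ≠ 0 ∧ A ≠ ∞ ∧ ∀ (N : ℝ≥0∞) (g : E n → ℝ≥0∞), N ≠ 0 → N ≠ ∞ →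
      Measurable g → MorreyBound Φ φ N g → ∀ (x₀ : E n) (r : ℝ), 0 < r → ∀ l : ℝ≥0∞,
        volume (Metric.ball x₀ r ∩ {x | l < maximal g x}) *
          Φ (l / (A * (N * scale n Φ φ r))) ≤ 1 := by
  obtain ⟨A, hA, h⟩ := exists_maximal_le_add hΦ hφ hdec
  obtain ⟨D, hD1, hD, hD'⟩ := hφ.exists_scale_two_mul_le hΦ hdec
  set ω := volume (Metric.ball (0 : E n) 1)
  have hω' : ω ≠ ∞ := volume_ball_ne_top _ _
  have hD0 : D ≠ 0 := (zero_lt_one.trans_le hD1).ne'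
  -- The first summand serves levels dominated by the far part. In the second, `4` collects the
  -- halving of `l` and the `l / 2` of the weak modular inequality, `D` the doubled ball, and `4 ^
  -- n` the weak type constant.
  refine ⟨2 * A * (2 * (1 + ω)) + 4 * D * 4 ^ n, ?_, ?_, ?_⟩
  · simp [hD0]
  · refine ENNReal.add_ne_top.2 ⟨?_, ?_⟩ <;> finiteness
  intro N g hN hN' hg hgN x₀ r hr l
  set A' := 2 * A * (2 * (1 + ω)) + 4 * D * 4 ^ n with hA'
  set T := N * scale n Φ φ r with hT
  have hT0 : T ≠ 0 := mul_ne_zero hN (hφ.scale_ne_zero hΦ hr)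
  have hT' : T ≠ ∞ := ENNReal.mul_ne_top hN' (scale_ne_top hΦ hr)
  set a := invPow n Φ r
  have hTa : T * a = N * ENNReal.ofReal (φ r) := by
    rw [mul_assoc, scale_mul_invPow hΦ hr]
  -- For low levels the volume of the whole ball is an adequate bound; for high levels the near part
  -- alone must exceed `l / 2`.
  rcases le_or_gt (l / 2) (A * N * ENNReal.ofReal (φ r)) with hl | hl
  · refine le_trans (mul_le_mul_left (measure_mono inter_subset_left) _)
      (hΦ.volume_ball_mul_le x₀ hr one_ne_zero le_rfl ?_)
    rw [div_one]
    refine ENNReal.div_le_of_le_mul ?_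
    have h1 : l ≤ 2 * A * (T * a) := by
      rw [hTa, ← mul_assoc, mul_assoc 2 A, mul_assoc 2 (A * N)]
      rwa [mul_comm, ← ENNReal.div_le_iff (by simp) (by simp)]
    calc l ≤ 2 * A * (T * a) := h1
      _ = 2 * A * T * (a / (2 * (1 + ω)) * (2 * (1 + ω))) := by
        rw [ENNReal.div_mul_cancel (by simp) (by finiteness)]; ring
      _ = a / (2 * (1 + ω)) * (2 * A * (2 * (1 + ω)) * T) := by ring
      _ ≤ _ := by
        gcongr
        exact le_self_add
  · set g₁ := (Metric.ball x₀ (2 * r)).indicator g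
    have hg₁ : Measurable g₁ := hg.indicator measurableSet_ball
    have hsub : Metric.ball x₀ r ∩ {x | l < maximal g x} ⊆
        {x | l / 2 / (D * T) < maximal (fun y => (D * T)⁻¹ * g₁ y) x} := by
      rintro x ⟨hx, hlx⟩
      rw [mem_ofPred_eq, maximal_mul_le _ (by simp [hT0, hD0]), ← ENNReal.div_eq_inv_mul]
      refine ENNReal.div_lt_div_right (by finiteness) (by finiteness) ?_
      by_contra! hc
      refine absurd (lt_of_lt_of_le hlx (h N g hN hN' hg hgN x₀ r hr x hx)) (not_lt.2 ?_)
      rw [← ENNReal.add_halves l]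
      exact add_le_add hc hl.le
    have h2 := hΦ.volume_lt_maximal_mul_le hn (hg₁.const_mul (D * T)⁻¹) (l / 2 / (D * T))
    have h3 := hgN.lintegral_indicator_le hΦ hD' x₀ hr
    have h4 : l / (A' * T) ≤ l / 2 / (D * T) / 2 / 4 ^ n := by
      rw [← ennreal_div_mul two_ne_zero (by simp), ← ennreal_div_mul (by finiteness) (by finiteness),
        ← ennreal_div_mul (by finiteness) (by finiteness)]
      gcongr l / ?_
      calc 2 * (D * T * (2 * 4 ^ n)) = 4 * D * 4 ^ n * T := by ring
        _ ≤ _ := by gcongr; exact le_add_self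
    calc _ ≤ volume {x | l / 2 / (D * T) < maximal (fun y => (D * T)⁻¹ * g₁ y) x} *
            (Φ (l / 2 / (D * T) / 2) / 4 ^ n) := by
          gcongr
          exact (hΦ.mono h4).trans (hΦ.map_div_le (one_le_pow₀ (by norm_num)) _)
      _ ≤ 4 ^ n * 1 / 4 ^ n := by
          rw [← mul_div_assoc]
          exact ENNReal.div_le_div_right (h2.trans (by gcongr)) _
      _ ≤ 1 := by
          rw [mul_one, ENNReal.div_self (by simp) (by simp)]

/-- The maximal operator is bounded on Orlicz-Morrey spaces under the `∇₂` condition. -/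
lemma exists_lintegral_maximal_le (hn : n ≠ 0) (hΦ : IsYoung Φ) (hN2 : Nabla2 Φ)
    (hφ : MemG n Φ φ) (hdec : AlmostDecreasing φ) :
    ∃ A : ℝ≥0∞, A ≠ 0 ∧ A ≠ ∞ ∧ ∀ (N : ℝ≥0∞) (g : E n → ℝ≥0∞), N ≠ 0 → N ≠ ∞ →
      Measurable g → (∀ x, g x ≠ ∞) → MorreyBound Φ φ N g → ∀ (x₀ : E n) (r : ℝ), 0 < r →
        ∫⁻ x in Metric.ball x₀ r, Φ (maximal g x / (A * (N * scale n Φ φ r))) ≤ 1 := by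
  obtain ⟨A, hA, h⟩ := exists_maximal_le_add hΦ hφ hdec
  obtain ⟨D, hD1, hD, hD'⟩ := hφ.exists_scale_two_mul_le hΦ hdec
  obtain ⟨C, hC, hCΦ⟩ := hN2
  set ω := volume (Metric.ball (0 : E n) 1)
  have hω' : ω ≠ ∞ := volume_ball_ne_top _ _
  have hD0 : D ≠ 0 := (zero_lt_one.trans_le hD1).ne'
  have hC1 : (1 : ℝ≥0∞) < C := by exact_mod_cast hC
  have hC0 : (C : ℝ≥0∞) ≠ 0 := (zero_lt_one.trans hC1).ne'
  -- `L` is twice the constant `2 * 4 ^ n` of the strong modular inequality, so the near part gets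
  -- modular at most `1/2`. The quotient by `2⁻¹` below does the same for the far part.
  set L : ℝ≥0∞ := 4 * 4 ^ n with hL
  refine ⟨2 * A * (2 * ((1 + ω) / 2⁻¹)) + 4 * C * D * L, ?_, ?_, ?_⟩
  · simp [hD0, hL, hC0]
  · refine ENNReal.add_ne_top.2 ⟨?_, ?_⟩
    · have : (1 + ω) / 2⁻¹ ≠ ∞ := ENNReal.div_ne_top (by finiteness) (by simp)
      finiteness
    · finiteness
  intro N g hN hN' hg hg' hgN x₀ r hr
  set A' := 2 * A * (2 * ((1 + ω) / 2⁻¹)) + 4 * C * D * L with hA'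
  set T := N * scale n Φ φ r with hT
  have hT0 : T ≠ 0 := mul_ne_zero hN (hφ.scale_ne_zero hΦ hr)
  have hT' : T ≠ ∞ := ENNReal.mul_ne_top hN' (scale_ne_top hΦ hr)
  set a := invPow n Φ r
  have hTa : T * a = N * ENNReal.ofReal (φ r) := by
    rw [mul_assoc, scale_mul_invPow hΦ hr]
  set g₁ := (Metric.ball x₀ (2 * r)).indicator g
  have hg₁ : Measurable g₁ := hg.indicator measurableSet_ball
  set c := A * N * ENNReal.ofReal (φ r) with hc
  set U : ℝ≥0∞ := 2 * C * L * (D * T) with hU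
  have hU0 : U ≠ 0 := by simp [hU, hC0, hL, hD0, hT0]
  have hU' : U ≠ ∞ := by simp only [hU]; finiteness
  have hUA : 2 * U ≤ A' * T := by
    calc 2 * U = 4 * C * D * L * T := by rw [hU]; ring
      _ ≤ _ := by gcongr; exact le_add_self
  have hpt : ∀ x ∈ Metric.ball x₀ r, Φ (maximal g x / (A' * T)) ≤
      Φ (maximal (fun y => U⁻¹ * g₁ y) x) + Φ (2 * c / (A' * T)) := by
    intro x hx
    have h1 := h N g hN hN' hg hgN x₀ r hr x hx
    -- The sum of near and far parts is at most twice the larger one, and `Φ` of the larger is at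
    -- most the sum of the two values.
    rcases le_total (maximal g₁ x) c with h2 | h2
    · refine le_trans (hΦ.mono ?_) le_add_self
      gcongr
      rw [two_mul]
      exact h1.trans (by gcongr)
    · refine le_trans (hΦ.mono ?_) le_self_add
      rw [maximal_mul_le _ (by simp [hU0]), ← ENNReal.div_eq_inv_mul]
      calc maximal g x / (A' * T) ≤ 2 * maximal g₁ x / (2 * U) := by
            gcongr
            rw [two_mul]
            exact h1.trans (by gcongr)
        _ = _ := ENNReal.mul_div_mul_left _ _ (by simp) (by simp)
  have hne : ∀ x, U⁻¹ * g₁ x ≠ ∞ := fun x => by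
    refine ENNReal.mul_ne_top (by simp [hU0]) ?_
    exact ne_top_of_le_ne_top (hg' x) (indicator_le_self _ _ _)
  have hI : ∫⁻ x, Φ (maximal (fun y => U⁻¹ * g₁ y) x) ≤ 2⁻¹ := by
    refine (hΦ.lintegral_maximal_le hn hC1 (by simp) hCΦ (hg₁.const_mul _) hne).trans ?_
    calc 2 * 4 ^ n * ∫⁻ x, Φ (2 * C * (U⁻¹ * g₁ x))
        ≤ 2 * 4 ^ n * ∫⁻ x, L⁻¹ * Φ ((D * T)⁻¹ * g₁ x) := by
          gcongr with x
          have h5 : 2 * C * (U⁻¹ * g₁ x) = L⁻¹ * ((D * T)⁻¹ * g₁ x) := by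
            have : U⁻¹ = (2 * (C : ℝ≥0∞))⁻¹ * (L⁻¹ * (D * T)⁻¹) := by
              have hL0 : L ≠ 0 := by simp [hL]
              have hL' : L ≠ ∞ := by finiteness
              rw [hU, mul_assoc (2 * (C : ℝ≥0∞)), ENNReal.mul_inv (.inl (by simp [hC0]))
                (.inl (by finiteness)), ENNReal.mul_inv (.inl hL0) (.inl hL')]
            rw [this, ← mul_assoc, ← mul_assoc, ENNReal.mul_inv_cancel (by simp [hC0])
              (by finiteness), one_mul, mul_assoc]
          rw [h5]
          refine hΦ.map_mul_le (ENNReal.inv_le_one.2 ?_) _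
          exact one_le_mul (by norm_num) (one_le_pow₀ (by norm_num))
      _ = 2 * 4 ^ n * (L⁻¹ * ∫⁻ x, Φ ((D * T)⁻¹ * g₁ x)) := by
          rw [lintegral_const_mul' _ _ (by simp [hL])]
      _ ≤ 2 * 4 ^ n * (L⁻¹ * 1) := by
          gcongr
          exact hgN.lintegral_indicator_le hΦ hD' x₀ hr
      _ = 2 * 4 ^ n / (2 * 4 ^ n * 2) := by
          rw [mul_one, ← div_eq_mul_inv, hL]; congr 1; ring
      _ ≤ 2⁻¹ := by
          rw [ennreal_div_mul (by simp) (by finiteness), ENNReal.div_self (by simp) (by finiteness),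
            one_div]
  calc ∫⁻ x in Metric.ball x₀ r, Φ (maximal g x / (A' * T))
      ≤ ∫⁻ x in Metric.ball x₀ r, (Φ (maximal (fun y => U⁻¹ * g₁ y) x) + Φ (2 * c / (A' * T))) :=
        setLIntegral_mono' measurableSet_ball hpt
    _ = (∫⁻ x in Metric.ball x₀ r, Φ (maximal (fun y => U⁻¹ * g₁ y) x)) +
          volume (Metric.ball x₀ r) * Φ (2 * c / (A' * T)) := by
        rw [lintegral_add_right _ measurable_const, setLIntegral_const, mul_comm (volume _)]
    _ ≤ 2⁻¹ + 2⁻¹ := by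
        gcongr
        · exact (setLIntegral_le_lintegral _ _).trans hI
        · refine hΦ.volume_ball_mul_le x₀ hr (by simp) (by simp) ?_
          refine ENNReal.div_le_of_le_mul ?_
          have hK : 2 * ((1 + ω) / 2⁻¹) ≠ ∞ := by
            have : (1 + ω) / 2⁻¹ ≠ ∞ := ENNReal.div_ne_top (by finiteness) (by simp)
            finiteness
          have hK0 : 2 * ((1 + ω) / 2⁻¹) ≠ 0 := by simp
          calc 2 * c = 2 * A * (T * a) := by rw [hTa, hc]; ring
            _ = 2 * A * T * (a / (2 * ((1 + ω) / 2⁻¹)) * (2 * ((1 + ω) / 2⁻¹))) := by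
              rw [ENNReal.div_mul_cancel hK0 hK]; ring
            _ = a / (2 * ((1 + ω) / 2⁻¹)) * (2 * A * (2 * ((1 + ω) / 2⁻¹)) * T) := by ring
            _ ≤ _ := by
              gcongr
              exact le_self_add
    _ = 1 := ENNReal.inv_two_add_inv_two

end MorreyMaximal

/-! ### Polar coordinates for radial functions -/

section Polar

variable {n : ℕ}

lemma lintegral_fun_norm (hn : n ≠ 0) {F : ℝ → ℝ≥0∞} (hF : Measurable F) :
    ∫⁻ x : E n, F ‖x‖ = n * volume (Metric.ball (0 : E n) 1) *
      ∫⁻ t in Ioi (0 : ℝ), ENNReal.ofReal (t ^ (n - 1)) * F t := by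
  have : NeZero n := ⟨hn⟩
  have : Nontrivial (E n) := inferInstance
  have hdim : Module.finrank ℝ (E n) = n := by simp
  calc ∫⁻ x : E n, F ‖x‖
      = ∫⁻ x : ({(0 : E n)}ᶜ : Set (E n)), F ‖x.1‖ ∂((volume : Measure (E n)).comap (↑)) := by
        rw [lintegral_subtype_comap (measurableSet_singleton _).compl fun x : E n => F ‖x‖,
          restrict_compl_singleton]
    _ = ∫⁻ p, F p.2 ∂(volume : Measure (E n)).toSphere.prod (Measure.volumeIoiPow (n - 1)) := by
        have h := (volume : Measure (E n)).measurePreserving_homeomorphUnitSphereProd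
        rw [hdim] at h
        rw [← h.lintegral_comp_emb (Homeomorph.measurableEmbedding _)]
        simp
    _ = (∫⁻ t : Ioi (0 : ℝ), F t ∂Measure.volumeIoiPow (n - 1)) *
          (volume : Measure (E n)).toSphere univ := by
        have hm : Measurable fun p : Metric.sphere (0 : E n) 1 × Ioi (0 : ℝ) => F p.2 :=
          hF.comp (measurable_subtype_coe.comp measurable_snd)
        rw [lintegral_prod _ hm.aemeasurable]
        exact lintegral_const (∫⁻ t : Ioi (0 : ℝ), F t ∂Measure.volumeIoiPow (n - 1))
    _ = _ := by
        rw [Measure.toSphere_apply_univ, hdim, mul_comm, Measure.volumeIoiPow,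
          lintegral_withDensity_eq_lintegral_mul _
            ((measurable_subtype_coe.pow_const _).ennreal_ofReal)
            (show Measurable fun t : Ioi (0 : ℝ) => F t from hF.comp measurable_subtype_coe)]
        congr 1
        exact lintegral_subtype_comap measurableSet_Ioi
          fun t : ℝ => ENNReal.ofReal (t ^ (n - 1)) * F t

/-- By polar coordinates, the set of points whose norm lies in a null set is null. This transfers
a.e. measurability of `ρ` on the half-line to the kernel. -/
lemma quasiMeasurePreserving_norm (hn : n ≠ 0) :
    Measure.QuasiMeasurePreserving (fun x : E n => ‖x‖) volume (volume.restrict (Ioi 0)) := by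
  refine ⟨measurable_norm, Measure.AbsolutelyContinuous.mk fun s hs h0 => ?_⟩
  rw [Measure.map_apply measurable_norm hs]
  have h1 := lintegral_fun_norm (n := n) hn (measurable_one.indicator hs (β := ℝ≥0∞))
  have h2 : ∫⁻ x : E n, s.indicator 1 ‖x‖ = volume ((fun x : E n => ‖x‖) ⁻¹' s) :=
    lintegral_indicator_one (measurable_norm hs)
  rw [← h2, h1]
  refine mul_eq_zero_of_right _ ?_
  refine lintegral_eq_zero_of_ae_eq_zero ?_
  filter_upwards [compl_mem_ae_iff.2 h0] with t ht
  simp [indicator_of_notMem ht]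

lemma lintegral_fun_norm_of_aemeasurable (hn : n ≠ 0) {F : ℝ → ℝ≥0∞}
    (hF : AEMeasurable F (volume.restrict (Ioi 0))) :
    ∫⁻ x : E n, F ‖x‖ = n * volume (Metric.ball (0 : E n) 1) *
      ∫⁻ t in Ioi (0 : ℝ), ENNReal.ofReal (t ^ (n - 1)) * F t := by
  have h1 : ∫⁻ x : E n, F ‖x‖ = ∫⁻ x : E n, hF.mk F ‖x‖ :=
    lintegral_congr_ae ((quasiMeasurePreserving_norm hn).ae_eq_comp hF.ae_eq_mk)
  rw [h1, lintegral_fun_norm hn hF.measurable_mk]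
  congr 1
  refine lintegral_congr_ae ?_
  filter_upwards [hF.ae_eq_mk] with t ht
  rw [ht]

end Polar

/-! ### Bounded overlap of dyadic dilates of an interval -/

section Dyadic

/-- A point lies in at most a fixed number of the intervals `(k₁ 2 ^ k, k₂ 2 ^ k)`. -/
lemma exists_tsum_lintegral_Ioo_le {k₁ k₂ : ℝ} (hk₁ : 0 < k₁) (hk : k₁ < k₂) :
    ∃ P : ℕ, ∀ h : ℝ → ℝ≥0∞, AEMeasurable h (volume.restrict (Ioi 0)) →
      ∑' k : ℤ, ∫⁻ t in Ioo (k₁ * 2 ^ k) (k₂ * 2 ^ k), h t ≤ P * ∫⁻ t in Ioi 0, h t := by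
  have hk₂ := hk₁.trans hk
  -- `t` lies in the `k`-th interval exactly when `t / k₂ < 2 ^ k < t / k₁`, a window of ratio `k₂ /
  -- k₁ < 2 ^ P`.
  obtain ⟨P, hP⟩ := pow_unbounded_of_one_lt (k₂ / k₁) one_lt_two
  refine ⟨P, fun h hh => ?_⟩
  have hsub : ∀ k : ℤ, Ioo (k₁ * 2 ^ k) (k₂ * 2 ^ k) ⊆ Ioi 0 := fun k t ht =>
    lt_trans (by positivity : (0 : ℝ) < k₁ * 2 ^ k) ht.1
  have h1 : ∀ k : ℤ, ∫⁻ t in Ioo (k₁ * 2 ^ k) (k₂ * 2 ^ k), h t =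
      ∫⁻ t in Ioi 0, (Ioo (k₁ * 2 ^ k) (k₂ * 2 ^ k)).indicator h t := fun k => by
    rw [lintegral_indicator measurableSet_Ioo, Measure.restrict_restrict measurableSet_Ioo,
      inter_eq_self_of_subset_left (hsub k)]
  simp_rw [h1]
  rw [← lintegral_tsum fun k => hh.indicator measurableSet_Ioo,
    ← lintegral_const_mul' _ _ (by simp)]
  refine setLIntegral_mono' measurableSet_Ioi fun t ht => ?_
  have ht0 : (0 : ℝ) < t := ht
  obtain ⟨j, hj1, hj2⟩ := exists_mem_Ioc_zpow (div_pos ht0 hk₂) (one_lt_two (α := ℝ))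
  have h2 : ∀ k : ℤ, k ∉ Finset.Ioo j (j + 1 + P) →
      (Ioo (k₁ * 2 ^ k) (k₂ * 2 ^ k)).indicator h t = 0 := by
    intro k hk'
    refine indicator_of_notMem (fun htk => hk' ?_) _
    rw [Finset.mem_Ioo]
    constructor
    · rw [← zpow_lt_zpow_iff_right₀ (one_lt_two (α := ℝ))]
      exact hj1.trans ((div_lt_iff₀ hk₂).2 (by linarith [htk.2]))
    · rw [← zpow_lt_zpow_iff_right₀ (one_lt_two (α := ℝ)), zpow_add₀ two_ne_zero, zpow_natCast]
      have h3 : (2 : ℝ) ^ k < t / k₁ := (lt_div_iff₀ hk₁).2 (by linarith [htk.1])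
      have h4 : t / k₁ = t / k₂ * (k₂ / k₁) := by field_simp
      rw [h4] at h3
      refine h3.trans_le ?_
      gcongr
  rw [tsum_eq_sum h2]
  calc ∑ k ∈ Finset.Ioo j (j + 1 + P), (Ioo (k₁ * 2 ^ k) (k₂ * 2 ^ k)).indicator h t
      ≤ ∑ k ∈ Finset.Ioo j (j + 1 + P), h t :=
        Finset.sum_le_sum fun k _ => indicator_le_self _ _ _
    _ = P * h t := by
        rw [Finset.sum_const, Int.card_Ioo, nsmul_eq_mul]
        congr 3
        omega

end Dyadic

/-! ### Reduction of the potential to a one-dimensional integral -/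

section Pointwise

variable {n : ℕ} {Φ : ℝ≥0∞ → ℝ≥0∞} {φ : ℝ → ℝ} {ρ : ℝ → ℝ}

/-- The kernel of the generalized fractional integral. -/
noncomputable def fracKernel (ρ : ℝ → ℝ) (z : E n) : ℝ≥0∞ := ENNReal.ofReal (ρ ‖z‖ / ‖z‖ ^ n)

/-- On each dyadic annulus around `x` the kernel is at most the supremum of `ρ` there times the
inner radius to the power `-n`; the annulus is then enlarged to a ball. -/
lemma lintegral_fracKernel_mul_le_tsum (hn : n ≠ 0) (ρ : ℝ → ℝ) {g : E n → ℝ≥0∞}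
    (hg : Measurable g) (x : E n) :
    ∫⁻ y, fracKernel ρ (x - y) * g y ≤
      ∑' k : ℤ, (⨆ t ∈ Icc ((2 : ℝ) ^ k / 2) (2 ^ k), ENNReal.ofReal (ρ t)) *
        ENNReal.ofReal (((2 : ℝ) ^ k / 2) ^ n)⁻¹ * ∫⁻ y in Metric.ball x (2 ^ k), g y := by
  set S : ℤ → Set (E n) := fun k => {y | (2 : ℝ) ^ k / 2 ≤ ‖x - y‖ ∧ ‖x - y‖ < 2 ^ k} with hS
  have hxm : Measurable fun y : E n => ‖x - y‖ := by fun_prop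
  have hSm : ∀ k, MeasurableSet (S k) := fun k =>
    MeasurableSet.inter (s₁ := {y | (2 : ℝ) ^ k / 2 ≤ ‖x - y‖}) (s₂ := {y | ‖x - y‖ < 2 ^ k})
      (measurableSet_le measurable_const hxm) (measurableSet_lt hxm measurable_const)
  have hcov : ∀ y, y ∉ ⋃ k, S k → fracKernel ρ (x - y) * g y = 0 := by
    intro y hy
    rcases eq_or_ne x y with rfl | hxy
    -- The annuli miss only `y = x`, where the kernel is `0` by the convention on division by zero,
    -- as `n ≠ 0`.
    · simp [fracKernel, hn]
    · obtain ⟨k, hk1, hk2⟩ := exists_mem_Ico_zpow (norm_pos_iff.2 (sub_ne_zero.2 hxy))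
        (one_lt_two (α := ℝ))
      refine absurd (mem_iUnion.2 ⟨k + 1, show _ ≤ _ ∧ _ < _ from ⟨?_, hk2⟩⟩) hy
      rw [zpow_add₀ two_ne_zero, zpow_one, mul_div_cancel_right₀ _ two_ne_zero]
      exact hk1
  calc ∫⁻ y, fracKernel ρ (x - y) * g y
      = ∫⁻ y in ⋃ k, S k, fracKernel ρ (x - y) * g y := by
        rw [← lintegral_indicator (MeasurableSet.iUnion hSm)]
        congr with y
        by_cases hy : y ∈ ⋃ k, S k
        · rw [indicator_of_mem hy]
        · rw [indicator_of_notMem hy, hcov y hy]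
    _ ≤ ∑' k, ∫⁻ y in S k, fracKernel ρ (x - y) * g y := lintegral_iUnion_le _ _
    _ ≤ _ := by
        refine ENNReal.tsum_le_tsum fun k => ?_
        have hk : (0 : ℝ) < 2 ^ k / 2 := by positivity
        calc ∫⁻ y in S k, fracKernel ρ (x - y) * g y
            ≤ ∫⁻ y in S k, (⨆ t ∈ Icc ((2 : ℝ) ^ k / 2) (2 ^ k), ENNReal.ofReal (ρ t)) *
                ENNReal.ofReal (((2 : ℝ) ^ k / 2) ^ n)⁻¹ * g y := by
              refine setLIntegral_mono' (hSm k) fun y hy => ?_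
              gcongr
              rw [fracKernel, div_eq_mul_inv, ENNReal.ofReal_mul' (by positivity)]
              gcongr
              · exact le_iSup₂ (f := fun t (_ : t ∈ Icc ((2 : ℝ) ^ k / 2) (2 ^ k)) =>
                  ENNReal.ofReal (ρ t)) ‖x - y‖ ⟨hy.1, hy.2.le⟩
              · exact hy.1
          _ ≤ ∫⁻ y in Metric.ball x (2 ^ k), (⨆ t ∈ Icc ((2 : ℝ) ^ k / 2) (2 ^ k),
                ENNReal.ofReal (ρ t)) * ENNReal.ofReal (((2 : ℝ) ^ k / 2) ^ n)⁻¹ * g y := by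
              refine lintegral_mono_set fun y hy => ?_
              rw [Metric.mem_ball, dist_comm, dist_eq_norm]
              exact hy.2
          _ = _ := lintegral_const_mul _ hg

/-- The potential of `g` is dominated by a one-dimensional integral. -/
lemma exists_lintegral_fracKernel_mul_le (hn : n ≠ 0) (hΦ : IsYoung Φ) (hφ : MemG n Φ φ)
    (hdec : AlmostDecreasing φ) (hφm : AEMeasurable φ (volume.restrict (Ioi 0)))
    (hρm : AEMeasurable ρ (volume.restrict (Ioi 0))) (hρ : SupCondition ρ) :
    ∃ A : ℝ≥0∞, A ≠ ∞ ∧ ∀ (N : ℝ≥0∞) (g : E n → ℝ≥0∞), N ≠ 0 → N ≠ ∞ → Measurable g →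
      MorreyBound Φ φ N g → ∀ x : E n,
        ∫⁻ y, fracKernel ρ (x - y) * g y ≤
          A * ∫⁻ t in Ioi 0, ENNReal.ofReal (ρ t / t) *
            min (maximal g x) (N * ENNReal.ofReal (φ t)) := by
  obtain ⟨C, k₁, k₂, hC, hk₁, hk, hsup⟩ := hρ
  obtain ⟨A, hA, hball⟩ := exists_lintegral_ball_le n hΦ φ hφ.pos
  obtain ⟨D, hD1, hD, hdbl⟩ := hφ.exists_le_mul hΦ hdec k₂
  obtain ⟨P, hP⟩ := exists_tsum_lintegral_Ioo_le hk₁ hk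
  set ω := volume (Metric.ball (0 : E n) 1)
  have hω' : ω ≠ ∞ := volume_ball_ne_top _ _
  set B : ℝ≥0∞ := ENNReal.ofReal C * (2 ^ n * ω) * (1 + A * D) with hB
  have hB' : B ≠ ∞ := by finiteness
  refine ⟨B * P, by finiteness, fun N g hN hN' hg hgN x => ?_⟩
  set M := maximal g x
  refine (lintegral_fracKernel_mul_le_tsum hn ρ hg x).trans ?_
  set h : ℝ → ℝ≥0∞ := fun t => ENNReal.ofReal (ρ t / t) * min M (N * ENNReal.ofReal (φ t)) with hh
  have hm : AEMeasurable h (volume.restrict (Ioi 0)) :=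
    (hρm.div aemeasurable_id).ennreal_ofReal.mul
      (aemeasurable_const.min (hφm.ennreal_ofReal.const_mul N))
  rw [mul_assoc]
  refine le_trans ?_ (mul_le_mul_right (hP h hm) B)
  rw [← ENNReal.tsum_mul_left]
  refine ENNReal.tsum_le_tsum fun k => ?_
  set r : ℝ := 2 ^ k with hr
  have hr0 : 0 < r := by positivity
  have hvol : ENNReal.ofReal ((r / 2) ^ n)⁻¹ * volume (Metric.ball x r) = 2 ^ n * ω := by
    rw [volume_ball_eq x hr0, ← mul_assoc, ← ENNReal.ofReal_mul (by positivity)]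
    congr 1
    rw [div_pow, inv_div, div_mul_cancel₀ _ (by positivity), ENNReal.ofReal_pow (by norm_num),
      ENNReal.ofReal_ofNat]
  have havg : ∫⁻ y in Metric.ball x r, g y ≤
      min M (A * N * ENNReal.ofReal (φ r)) * volume (Metric.ball x r) := by
    rw [min_mul_of_nonneg _ _ (by simp)]
    refine le_min ?_ (hball N g hN hN' hg hgN x r hr0)
    rw [← ENNReal.div_le_iff (volume_ball_ne_zero x hr0) (volume_ball_ne_top x r)]
    exact laverage_le_maximal g x k
  -- Doubling replaces `φ r` by `φ t` on the interval from condition (b), so that the minimum can go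
  -- under the integral.
  have hmin : ∀ t ∈ Ioo (k₁ * r) (k₂ * r), min M (A * N * ENNReal.ofReal (φ r)) ≤
      (1 + A * D) * min M (N * ENNReal.ofReal (φ t)) := by
    intro t ht
    rw [mul_min]
    refine min_le_min (le_mul_of_one_le_left (by simp) le_self_add) ?_
    calc A * N * ENNReal.ofReal (φ r) ≤ A * N * (D * ENNReal.ofReal (φ t)) := by
          gcongr
          exact hdbl r t hr0 (lt_trans (by positivity) ht.1) ht.2.le
      _ = A * D * (N * ENNReal.ofReal (φ t)) := by ring
      _ ≤ _ := by gcongr; exact le_add_self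
  calc (⨆ t ∈ Icc (r / 2) r, ENNReal.ofReal (ρ t)) * ENNReal.ofReal ((r / 2) ^ n)⁻¹ *
        ∫⁻ y in Metric.ball x r, g y
      ≤ (ENNReal.ofReal C * ∫⁻ t in Ioo (k₁ * r) (k₂ * r), ENNReal.ofReal (ρ t / t)) *
          ENNReal.ofReal ((r / 2) ^ n)⁻¹ *
            (min M (A * N * ENNReal.ofReal (φ r)) * volume (Metric.ball x r)) := by
        gcongr
        exact hsup r hr0
    _ = ENNReal.ofReal C * (2 ^ n * ω) * ((∫⁻ t in Ioo (k₁ * r) (k₂ * r),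
          ENNReal.ofReal (ρ t / t)) * min M (A * N * ENNReal.ofReal (φ r))) := by
        rw [← hvol]; ring
    _ = ENNReal.ofReal C * (2 ^ n * ω) * ∫⁻ t in Ioo (k₁ * r) (k₂ * r),
          ENNReal.ofReal (ρ t / t) * min M (A * N * ENNReal.ofReal (φ r)) := by
        rw [lintegral_mul_const' _ _ (ne_top_of_le_ne_top (by finiteness) (min_le_right _ _))]
    _ ≤ ENNReal.ofReal C * (2 ^ n * ω) * ∫⁻ t in Ioo (k₁ * r) (k₂ * r), (1 + A * D) * h t := by
        refine mul_le_mul_right (setLIntegral_mono' measurableSet_Ioo fun t ht => ?_) _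
        calc _ ≤ ENNReal.ofReal (ρ t / t) * ((1 + A * D) * min M (N * ENNReal.ofReal (φ t))) := by
              gcongr; exact hmin t ht
          _ = _ := by simp only [hh]; ring
    _ = B * ∫⁻ t in Ioo (k₁ * r) (k₂ * r), h t := by
        rw [lintegral_const_mul' _ _ (by finiteness), hB]; ring

end Pointwise

/-! ### Hedberg's inequality -/

section Hedberg

variable {n : ℕ} {Φ : ℝ≥0∞ → ℝ≥0∞} {φ : ℝ → ℝ} {ρ : ℝ → ℝ}

lemma lintegral_min_le (hρ_pos : ∀ t, 0 < t → 0 < ρ t) {v : ℝ≥0∞} (hv : v ≠ ∞) {r : ℝ}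
    (hr : 0 < r) :
    ∫⁻ t in Ioi 0, ENNReal.ofReal (ρ t / t) * min v (ENNReal.ofReal (φ t)) ≤
      v * rhoInt ρ r + tailInt ρ φ r := by
  rw [← Ioo_union_Ici_eq_Ioi hr]
  refine (lintegral_union_le _ _ _).trans (add_le_add ?_ ?_)
  · rw [rhoInt, mul_comm, ← lintegral_mul_const' _ _ hv]
    refine lintegral_mono fun t => ?_
    gcongr
    exact min_le_left _ _
  · rw [tailInt, setLIntegral_congr Ioi_ae_eq_Ici.symm]
    refine setLIntegral_mono' measurableSet_Ioi fun t ht => ?_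
    have ht0 : 0 < t := hr.trans ht
    calc _ ≤ ENNReal.ofReal (ρ t / t) * ENNReal.ofReal (φ t) := by
          gcongr; exact min_le_right _ _
      _ = _ := by
          rw [← ENNReal.ofReal_mul (div_pos (hρ_pos t ht0) ht0).le]
          congr 1
          ring

/-- An almost decreasing doubling function takes, up to constants, every value between its
infimum and its supremum. -/
lemma MemG.exists_comparable (hΦ : IsYoung Φ) (hφ : MemG n Φ φ) (hdec : AlmostDecreasing φ) :
    ∃ D : ℝ≥0∞, 1 ≤ D ∧ D ≠ ∞ ∧ ∀ A v : ℝ≥0∞, 1 ≤ A →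
      (∃ k : ℤ, v ≤ A * ENNReal.ofReal (φ (2 ^ k))) →
      (∀ k : ℤ, v ≤ ENNReal.ofReal (φ (2 ^ k))) ∨
      ∃ r, 0 < r ∧ v ≤ A * ENNReal.ofReal (φ r) ∧ ENNReal.ofReal (φ r) ≤ D * v := by
  obtain ⟨D, hD1, hD, hdbl⟩ := hφ.exists_le_mul hΦ hdec 2
  have h2 : ∀ k : ℤ, (0 : ℝ) < 2 ^ k := fun k => by positivity
  refine ⟨D, hD1, hD, fun A v hA ⟨k₀, hk₀⟩ => ?_⟩
  by_cases hall : ∀ k : ℤ, v ≤ ENNReal.ofReal (φ (2 ^ k))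
  · exact .inl hall
  right
  push Not at hall
  obtain ⟨k₁, hk₁⟩ := hall
  by_cases h0 : ENNReal.ofReal (φ (2 ^ k₀)) ≤ v
  · exact ⟨2 ^ k₀, h2 _, hk₀, h0.trans (le_mul_of_one_le_left (by simp) hD1)⟩
  push Not at h0
  -- Here `φ(2 ^ k₁) < v < φ(2 ^ k₀)`. If `k₁ ≤ k₀`, almost decrease already gives comparability.
  -- Otherwise stop at the first index past `k₀` with `φ ≤ v`: the preceding value exceeds `v`, and
  -- by doubling it is at most `D * v`.
  rcases le_total k₁ k₀ with hk | hk
  · refine ⟨2 ^ k₀, h2 _, hk₀, (hdbl _ _ (h2 k₀) (h2 k₁) ?_).trans (by gcongr)⟩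
    have : (2 : ℝ) ^ k₁ ≤ 2 ^ k₀ := zpow_le_zpow_right₀ one_le_two hk
    linarith [h2 k₀]
  · have hex : ∃ j : ℕ, ENNReal.ofReal (φ (2 ^ (k₀ + j))) ≤ v :=
      ⟨(k₁ - k₀).toNat, by rw [show k₀ + ((k₁ - k₀).toNat : ℤ) = k₁ by omega]; exact hk₁.le⟩
    classical
    obtain ⟨i, hi⟩ : ∃ i, Nat.find hex = i + 1 := Nat.exists_eq_succ_of_ne_zero fun h => by
      have h1 := Nat.find_spec hex
      rw [h] at h1
      exact absurd (by simpa using h1) (not_le.2 h0)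
    have h3 := Nat.find_spec hex
    rw [hi] at h3
    have h4 : v < ENNReal.ofReal (φ (2 ^ (k₀ + i))) :=
      not_le.1 (Nat.find_min hex (m := i) (by omega))
    refine ⟨2 ^ (k₀ + i), h2 _, h4.le.trans (le_mul_of_one_le_left (by simp) hA),
      (hdbl _ (2 ^ (k₀ + (i + 1 : ℕ))) (h2 _) (h2 _) ?_).trans (by gcongr)⟩
    rw [Nat.cast_succ, ← add_assoc, zpow_add₀ two_ne_zero (k₀ + i) 1, zpow_one, mul_comm]

lemma exists_lintegral_min_le (hΦ : IsYoung Φ) (hφ : MemG n Φ φ) (hdec : AlmostDecreasing φ)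
    (hρ_pos : ∀ t, 0 < t → 0 < ρ t) {β : ℝ} (hβ : β ∈ Ioo (0 : ℝ) 1) {C A : ℝ≥0∞} (hC : C ≠ ∞)
    (hA : A ≠ ∞) (hA1 : 1 ≤ A)
    (h : ∀ r, 0 < r → ENNReal.ofReal (φ r) * rhoInt ρ r + tailInt ρ φ r ≤
      C * ENNReal.ofReal (φ r) ^ β) :
    ∃ B : ℝ≥0∞, B ≠ ∞ ∧ ∀ v : ℝ≥0∞, v ≠ ∞ → (∃ k : ℤ, v ≤ A * ENNReal.ofReal (φ (2 ^ k))) →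
      ∫⁻ t in Ioi 0, ENNReal.ofReal (ρ t / t) * min v (ENNReal.ofReal (φ t)) ≤ B * v ^ β := by
  obtain ⟨D, hD1, hD, hcomp⟩ := hφ.exists_comparable hΦ hdec
  have hβ0 := hβ.1.le
  have hDβ : D ^ β ≠ ∞ := ENNReal.rpow_ne_top_of_nonneg hβ0 hD
  refine ⟨C + A * (C * D ^ β), by finiteness, fun v hv hk => ?_⟩
  rcases eq_or_ne v 0 with rfl | hv0
  · simp
  rcases hcomp A v hA1 hk with hall | ⟨r, hr, hvr, hrv⟩
  -- No radius need be comparable to `v` here. Exhaust the half-line by `(0, 2 ^ k)` and bound the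
  -- minimum by `v`; with `F = φ(2 ^ k) ≥ v`, the estimate `v ≤ v ^ β * F ^ (1 - β)` makes all
  -- powers of `F` cancel.
  · refine le_trans ?_ (mul_le_mul_left le_self_add _)
    have hU : (Ioi (0 : ℝ)) = ⋃ k : ℕ, Ioo (0 : ℝ) (2 ^ k) := by
      ext t
      simp only [mem_Ioi, mem_iUnion, mem_Ioo, exists_and_left, iff_self_and]
      exact fun _ => pow_unbounded_of_one_lt t one_lt_two
    rw [hU, setLIntegral_iUnion_of_directed _ (Monotone.directed_le fun i j hij =>
      Ioo_subset_Ioo_right (pow_le_pow_right₀ one_le_two hij))]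
    refine iSup_le fun k => ?_
    have hr : (0 : ℝ) < 2 ^ k := by positivity
    set F := ENNReal.ofReal (φ (2 ^ k)) with hF
    have hF0 : F ≠ 0 := by simpa [hF] using hφ.pos _ hr
    have hF' : F ≠ ∞ := ENNReal.ofReal_ne_top
    have hvF : v ≤ F := by simpa using hall k
    have h1 : ∫⁻ t in Ioo (0 : ℝ) (2 ^ k), ENNReal.ofReal (ρ t / t) * min v (ENNReal.ofReal (φ t))
        ≤ v * rhoInt ρ (2 ^ k) := by
      rw [rhoInt, mul_comm, ← lintegral_mul_const' _ _ hv]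
      refine lintegral_mono fun t => ?_
      gcongr
      exact min_le_left _ _
    refine h1.trans ?_
    rw [← ENNReal.mul_le_mul_iff_left hF0 hF']
    have hsplit : ∀ w : ℝ≥0∞, w ≠ 0 → w ≠ ∞ → w = w ^ β * w ^ (1 - β) := fun w h0 h1 => by
      rw [← ENNReal.rpow_add _ _ h0 h1, add_sub_cancel, ENNReal.rpow_one]
    calc v * rhoInt ρ (2 ^ k) * F = v * (F * rhoInt ρ (2 ^ k)) := by ring
      _ ≤ v * (C * F ^ β) := by
          exact mul_le_mul_right (le_self_add.trans (h _ hr)) _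
      _ = C * (v ^ β * v ^ (1 - β) * F ^ β) := by rw [← hsplit v hv0 hv]; ring
      _ ≤ C * (v ^ β * F ^ (1 - β) * F ^ β) := by
          gcongr
          linarith [hβ.2]
      _ = C * v ^ β * (F ^ β * F ^ (1 - β)) := by ring
      _ = C * v ^ β * F := by rw [← hsplit F hF0 hF']
  · refine le_trans ?_ (mul_le_mul_left le_add_self _)
    set F := ENNReal.ofReal (φ r)
    calc _ ≤ v * rhoInt ρ r + tailInt ρ φ r := lintegral_min_le hρ_pos hv hr
      _ ≤ A * F * rhoInt ρ r + A * tailInt ρ φ r := by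
          gcongr
          exact le_mul_of_one_le_left (by simp) hA1
      _ = A * (F * rhoInt ρ r + tailInt ρ φ r) := by ring
      _ ≤ A * (C * F ^ β) := by gcongr; exact h r hr
      _ ≤ A * (C * (D * v) ^ β) := by gcongr
      _ = _ := by rw [ENNReal.mul_rpow_of_nonneg _ _ hβ0]; ring

/-- A Hedberg type pointwise inequality. -/
lemma exists_lintegral_fracKernel_le_rpow (hn : n ≠ 0) (hΦ : IsYoung Φ) (hφ : MemG n Φ φ)
    (hdec : AlmostDecreasing φ) (hφm : AEMeasurable φ (volume.restrict (Ioi 0)))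
    (hρm : AEMeasurable ρ (volume.restrict (Ioi 0))) (hρ : SupCondition ρ)
    (hρ_pos : ∀ t, 0 < t → 0 < ρ t) {β : ℝ} (hβ : β ∈ Ioo (0 : ℝ) 1) {C : ℝ≥0∞} (hC : C ≠ ∞)
    (h : ∀ r, 0 < r → ENNReal.ofReal (φ r) * rhoInt ρ r + tailInt ρ φ r ≤
      C * ENNReal.ofReal (φ r) ^ β) :
    ∃ A : ℝ≥0∞, A ≠ 0 ∧ A ≠ ∞ ∧ ∀ (N : ℝ≥0∞) (g : E n → ℝ≥0∞), N ≠ 0 → N ≠ ∞ → Measurable g →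
      MorreyBound Φ φ N g → ∀ x : E n,
        ∫⁻ y, fracKernel ρ (x - y) * g y ≤ A * N * (maximal g x / N) ^ β := by
  obtain ⟨A₁, hA₁, h₁⟩ := exists_lintegral_ball_le n hΦ φ hφ.pos
  obtain ⟨A₂, hA₂, h₂⟩ := exists_lintegral_fracKernel_mul_le hn hΦ hφ hdec hφm hρm hρ
  obtain ⟨B, hB, h₃⟩ := exists_lintegral_min_le hΦ hφ hdec hρ_pos hβ hC
    (A := 1 + 2 * A₁) (by finiteness) le_self_add h
  refine ⟨1 + A₂ * B, by simp, by finiteness, fun N g hN hN' hg hgN x => ?_⟩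
  set M := maximal g x with hM
  rcases eq_or_ne M ∞ with hMt | hMt
  · rw [hMt, ENNReal.top_div_of_ne_top hN', ENNReal.top_rpow_of_pos hβ.1, ENNReal.mul_top]
    · exact le_top
    · exact mul_ne_zero (by simp) hN
  -- Some dyadic average exceeds `M / 2`, and every average is at most `A₁ N φ(2 ^ k)`; hence `v` is
  -- never far above the values of `φ`.
  have hk : ∃ k : ℤ, M / N ≤ (1 + 2 * A₁) * ENNReal.ofReal (φ (2 ^ k)) := by
    rcases eq_or_ne M 0 with hM0 | hM0
    · exact ⟨0, by simp [hM0]⟩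
    obtain ⟨k, hk⟩ := lt_iSup_iff.1 (show M / 2 < maximal g x from ENNReal.half_lt_self hM0 hMt)
    refine ⟨k, ENNReal.div_le_of_le_mul ?_⟩
    have hr : (0 : ℝ) < 2 ^ k := by positivity
    have h4 : M / 2 ≤ A₁ * N * ENNReal.ofReal (φ (2 ^ k)) := by
      refine hk.le.trans ?_
      rw [ENNReal.div_le_iff (volume_ball_ne_zero x hr) (volume_ball_ne_top x _)]
      exact h₁ N g hN hN' hg hgN x _ hr
    rw [ENNReal.div_le_iff two_ne_zero (by simp)] at h4
    calc M ≤ A₁ * N * ENNReal.ofReal (φ (2 ^ k)) * 2 := h4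
      _ = 2 * A₁ * ENNReal.ofReal (φ (2 ^ k)) * N := by ring
      _ ≤ _ := by gcongr; exact le_add_self
  have h5 := h₃ (M / N) (ENNReal.div_ne_top hMt hN) hk
  calc ∫⁻ y, fracKernel ρ (x - y) * g y
      ≤ A₂ * ∫⁻ t in Ioi 0, ENNReal.ofReal (ρ t / t) * min M (N * ENNReal.ofReal (φ t)) :=
        h₂ N g hN hN' hg hgN x
    _ = A₂ * (N * ∫⁻ t in Ioi 0, ENNReal.ofReal (ρ t / t) *
          min (M / N) (ENNReal.ofReal (φ t))) := by
        rw [← lintegral_const_mul' _ _ hN']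
        congr with t
        have h6 : N * min (M / N) (ENNReal.ofReal (φ t)) = min M (N * ENNReal.ofReal (φ t)) := by
          rw [mul_min, ENNReal.mul_div_cancel hN hN']
        rw [mul_left_comm N, h6]
    _ ≤ A₂ * (N * (B * (M / N) ^ β)) := by gcongr
    _ = A₂ * B * N * (M / N) ^ β := by ring
    _ ≤ _ := by gcongr; exact le_add_self

end Hedberg

/-! ### Sufficiency: from the maximal operator to `I_ρ` -/

section FracIntegral

variable {𝕜 : Type*} [RCLike 𝕜] {n : ℕ} {Φ : ℝ≥0∞ → ℝ≥0∞} {φ : ℝ → ℝ} {ρ : ℝ → ℝ}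

lemma enorm_fracIntegrand (hn : n ≠ 0) (hρ_pos : ∀ t, 0 < t → 0 < ρ t) (f : E n → 𝕜) (x y : E n) :
    ‖fracIntegrand ρ f x y‖ₑ = fracKernel ρ (x - y) * ‖f y‖ₑ := by
  have h : 0 ≤ ρ ‖x - y‖ / ‖x - y‖ ^ n := by
    rcases eq_or_ne x y with rfl | hxy
    · simp [hn]
    · have := norm_pos_iff.2 (sub_ne_zero.2 hxy)
      exact div_nonneg (hρ_pos _ this).le (by positivity)
  rw [fracIntegrand, enorm_smul, Real.enorm_of_nonneg h, fracKernel]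

lemma aestronglyMeasurable_fracIntegrand (hn : n ≠ 0)
    (hρm : AEMeasurable ρ (volume.restrict (Ioi 0))) {f : E n → 𝕜} (hf : AEStronglyMeasurable f) :
    AEStronglyMeasurable (fun p : E n × E n => fracIntegrand ρ f p.1 p.2)
      ((volume : Measure (E n)).prod volume) := by
  have h1 : AEMeasurable (fun z : E n => ρ ‖z‖) :=
    hρm.comp_quasiMeasurePreserving (quasiMeasurePreserving_norm hn)
  have h2 : AEMeasurable (fun z : E n => ρ ‖z‖ / ‖z‖ ^ n) := h1.div (by fun_prop)
  have h3 : AEMeasurable (fun p : E n × E n => ρ ‖p.1 - p.2‖ / ‖p.1 - p.2‖ ^ n)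
      ((volume : Measure (E n)).prod volume) :=
    h2.comp_quasiMeasurePreserving (quasiMeasurePreserving_sub volume volume)
  exact h3.aestronglyMeasurable.smul hf.comp_snd

/-- The maximal function of a function in an Orlicz-Morrey space is finite almost everywhere. -/
lemma MorreyBound.ae_maximal_ne_top (hn : n ≠ 0) (hΦ : IsYoung Φ) (hφ : MemG n Φ φ)
    (hdec : AlmostDecreasing φ) {N : ℝ≥0∞} (hN : N ≠ 0) (hN' : N ≠ ∞) {g : E n → ℝ≥0∞}
    (hg : Measurable g) (hgN : MorreyBound Φ φ N g) : ∀ᵐ x, maximal g x ≠ ∞ := by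
  obtain ⟨A, hA, hA', h⟩ := exists_volume_lt_maximal_le hn hΦ hφ hdec
  have h1 : ∀ k : ℕ, volume (Metric.ball (0 : E n) (k + 1) ∩ {x | maximal g x = ∞}) = 0 := by
    intro k
    set V := volume (Metric.ball (0 : E n) (k + 1) ∩ {x | maximal g x = ∞}) with hV
    by_contra hV0
    have hV' : V ≠ ∞ := ne_top_of_le_ne_top (volume_ball_ne_top (0 : E n) (k + 1))
      (measure_mono inter_subset_left)
    have hk : (0 : ℝ) < k + 1 := by positivity
    set T := A * (N * scale n Φ φ (k + 1))
    have hT : T ≠ 0 := mul_ne_zero hA (mul_ne_zero hN (hφ.scale_ne_zero hΦ hk))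
    have hT' : T ≠ ∞ := ENNReal.mul_ne_top hA' (ENNReal.mul_ne_top hN' (scale_ne_top hΦ hk))
    -- On the exceptional set every level is exceeded, so the weak bound at level `w * T` would give
    -- `V * Φ w ≤ 1`, against the choice of `w`.
    obtain ⟨w, hw, hVw⟩ := hΦ.exists_lt_map (s := V⁻¹) (by simpa using hV0)
    have h2 := h N g hN hN' hg hgN 0 (k + 1) hk (w * T)
    rw [ENNReal.mul_div_cancel_right hT hT'] at h2
    refine absurd (le_trans ?_ h2) (not_le.2 ((?_ : 1 < V * Φ w)))
    · refine mul_le_mul_left (measure_mono (inter_subset_inter_right _ fun x hx => ?_)) _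
      rw [mem_ofPred_eq, show maximal g x = ∞ from hx]
      exact (ENNReal.mul_ne_top hw hT').lt_top
    · rw [← ENNReal.mul_inv_cancel hV0 hV']
      exact ENNReal.mul_lt_mul_right hV0 hV' hVw
  have h3 : {x | ¬ maximal g x ≠ ∞} ⊆
      ⋃ k : ℕ, Metric.ball (0 : E n) (k + 1) ∩ {x | maximal g x = ∞} := by
    intro x hx
    obtain ⟨k, hk⟩ := exists_nat_gt ‖x‖
    refine mem_iUnion.2 ⟨k, ?_, not_not.1 hx⟩
    rw [mem_ball_zero_iff]
    linarith
  exact measure_mono_null h3 (measure_iUnion_null h1)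

/-- The pointwise control of `I_ρ f` by the maximal function of (a version of) `|f|`. -/
lemma exists_lintegral_enorm_fracIntegrand_le (hn : n ≠ 0) (hΦ : IsYoung Φ) (hφ : MemG n Φ φ)
    (hdec : AlmostDecreasing φ) (hφm : AEMeasurable φ (volume.restrict (Ioi 0)))
    (hρm : AEMeasurable ρ (volume.restrict (Ioi 0))) (hρ : SupCondition ρ)
    (hρ_pos : ∀ t, 0 < t → 0 < ρ t) {β : ℝ} (hβ : β ∈ Ioo (0 : ℝ) 1) {C : ℝ≥0∞} (hC : C ≠ ∞)
    (h : ∀ r, 0 < r → ENNReal.ofReal (φ r) * rhoInt ρ r + tailInt ρ φ r ≤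
      C * ENNReal.ofReal (φ r) ^ β) :
    ∃ A : ℝ≥0∞, A ≠ 0 ∧ A ≠ ∞ ∧ ∀ (f : E n → 𝕜) (N : ℝ≥0∞), AEStronglyMeasurable f → N ≠ ∞ →
      morreyNorm Φ φ f < N → ∃ g : E n → ℝ≥0∞, Measurable g ∧ (∀ x, g x ≠ ∞) ∧
        MorreyBound Φ φ N g ∧ (∀ᵐ x, Integrable (fracIntegrand ρ f x)) ∧
        ∀ x, ‖fracInt ρ f x‖ₑ ≤ A * N * (maximal g x / N) ^ β := by
  obtain ⟨A, hA, hA', hker⟩ := exists_lintegral_fracKernel_le_rpow hn hΦ hφ hdec hφm hρm hρ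
    hρ_pos hβ hC h
  refine ⟨A, hA, hA', fun f N hf hN' hN => ?_⟩
  have hN0 : N ≠ 0 := (zero_le.trans_lt hN).ne'
  -- The maximal estimates require a Borel function; passing to a representative changes neither the
  -- integrals nor the modular bound.
  set g : E n → ℝ≥0∞ := fun x => ‖hf.mk f x‖ₑ
  have hg : Measurable g := hf.stronglyMeasurable_mk.enorm
  have hfg : (fun x => ‖f x‖ₑ) =ᵐ[volume] g := by
    filter_upwards [hf.ae_eq_mk] with x hx
    simp only [g, hx]
  have hgN : MorreyBound Φ φ N g := (morreyBound_of_morreyNorm_lt hΦ hφ hN).congr hfg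
  have hle : ∀ x, ∫⁻ y, ‖fracIntegrand ρ f x y‖ₑ ≤ A * N * (maximal g x / N) ^ β := by
    intro x
    refine le_trans (le_of_eq ?_) (hker N g hN0 hN' hg hgN x)
    refine lintegral_congr_ae ?_
    filter_upwards [hfg] with y hy
    rw [enorm_fracIntegrand hn hρ_pos, hy]
  refine ⟨g, hg, fun x => by simp [g], hgN, ?_, fun x =>
    (enorm_integral_le_lintegral_enorm _).trans (hle x)⟩
  filter_upwards [hgN.ae_maximal_ne_top hn hΦ hφ hdec hN0 hN' hg,
    (aestronglyMeasurable_fracIntegrand hn hρm hf).prodMk_left] with x hx hxm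
  refine ⟨hxm, (hle x).trans_lt ?_⟩
  have : (maximal g x / N) ^ β ≠ ∞ :=
    ENNReal.rpow_ne_top_of_nonneg hβ.1.le (ENNReal.div_ne_top hx hN0)
  exact (by finiteness : A * N * (maximal g x / N) ^ β ≠ ∞).lt_top

/-- Dividing Hedberg's bound by `A * B ^ β * N * S ^ β` leaves `(M / (B * (N * S))) ^ β`, and the
power `1 / β` in `Ψ` undoes the `β`. This carries the strong estimate from `M` to `I_ρ f`. -/
lemma div_rpow_one_div_le {β : ℝ} (hβ : 0 < β) {A B N S u M : ℝ≥0∞}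
    (hB : B ≠ 0) (hB' : B ≠ ∞) (hN : N ≠ 0) (hN' : N ≠ ∞) (hS : S ≠ 0) (hS' : S ≠ ∞)
    (hu : u ≤ A * N * (M / N) ^ β) :
    (u / (A * B ^ β * N * S ^ β)) ^ (1 / β) ≤ M / (B * (N * S)) := by
  rw [one_div, ENNReal.rpow_inv_le_iff hβ]
  refine ENNReal.div_le_of_le_mul (hu.trans_eq ?_)
  have h1 : M / N = M / (B * (N * S)) * B * S := by
    rw [mul_assoc, show B * (N * S) = N * (B * S) by ring, ennreal_div_mul hN hN',
      ENNReal.div_mul_cancel (mul_ne_zero hB hS) (ENNReal.mul_ne_top hB' hS')]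
  rw [h1, ENNReal.mul_rpow_of_nonneg _ _ hβ.le, ENNReal.mul_rpow_of_nonneg _ _ hβ.le]
  ring

/-- The level-set counterpart: the level `l` of `I_ρ f` corresponds to an explicit level of the
maximal function. -/
lemma le_of_le_div_rpow_one_div {β : ℝ} (hβ : 0 < β) {A B N S u M l : ℝ≥0∞}
    (hA : A ≠ 0) (hA' : A ≠ ∞) (hB : B ≠ 0) (hB' : B ≠ ∞) (hN : N ≠ 0) (hN' : N ≠ ∞) (hS : S ≠ 0)
    (hS' : S ≠ ∞) (hu : u ≤ A * N * (M / N) ^ β)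
    (hM : M ≤ (l / (A * B ^ β * N * S ^ β)) ^ (1 / β) * (B * (N * S))) : u ≤ l := by
  have hBβ : B ^ β ≠ 0 := by simp [ENNReal.rpow_eq_zero_iff, hB, hB']
  have hBβ' : B ^ β ≠ ∞ := ENNReal.rpow_ne_top_of_nonneg hβ.le hB'
  have hSβ : S ^ β ≠ 0 := by simp [ENNReal.rpow_eq_zero_iff, hS, hS']
  have hSβ' : S ^ β ≠ ∞ := ENNReal.rpow_ne_top_of_nonneg hβ.le hS'
  set W := A * B ^ β * N * S ^ β with hW
  have hW0 : W ≠ 0 := mul_ne_zero (mul_ne_zero (mul_ne_zero hA hBβ) hN) hSβ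
  have hW' : W ≠ ∞ := by finiteness
  have h1 : M / N ≤ (l / W) ^ (1 / β) * (B * S) := by
    rw [ENNReal.div_le_iff hN hN']
    refine hM.trans_eq (by ring)
  calc u ≤ A * N * (M / N) ^ β := hu
    _ ≤ A * N * ((l / W) ^ (1 / β) * (B * S)) ^ β := by gcongr
    _ = l / W * W := by
        rw [ENNReal.mul_rpow_of_nonneg _ _ hβ.le, ENNReal.mul_rpow_of_nonneg _ _ hβ.le,
          ← ENNReal.rpow_mul, one_div, inv_mul_cancel₀ hβ.ne', ENNReal.rpow_one]
        nth_rw 3 [hW]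
        ring
    _ = l := ENNReal.div_mul_cancel hW0 hW'

lemma inv_mul_invPow_comp_rpow (hΦ : IsYoung Φ) (hφ : MemG n Φ φ) {β : ℝ} (hβ : 0 < β)
    {η : ℝ → ℝ} (hη : ∀ t, 0 < t → η t = φ t ^ β) {r : ℝ} (hr : 0 < r) :
    (ENNReal.ofReal (η r))⁻¹ * invPow n (fun t => Φ (t ^ (1 / β))) r =
      (scale n Φ φ r ^ β)⁻¹ := by
  have ha := hΦ.invPow_ne_zero (n := n) hr
  have ha' := hΦ.invPow_ne_top (n := n) r
  rw [invPow_comp_rpow hβ, hη r hr, ← ENNReal.ofReal_rpow_of_pos (hφ.pos r hr), scale,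
    ENNReal.div_rpow_of_nonneg _ _ hβ.le, ENNReal.inv_div, mul_comm, div_eq_mul_inv]
  · exact .inl (ENNReal.rpow_ne_top_of_nonneg hβ.le ha')
  · exact .inl (by simp [ENNReal.rpow_eq_zero_iff, ha, ha'])

lemma le_of_inv_mul_le {a b c : ℝ≥0∞} (h : a ≤ c * b) :
    b⁻¹ * a ≤ c := by
  rw [← ENNReal.div_eq_inv_mul]
  exact ENNReal.div_le_of_le_mul h

lemma rpow_ne_zero_ne_top {a : ℝ≥0∞} (ha : a ≠ 0) (ha' : a ≠ ∞) {β : ℝ} (hβ : 0 ≤ β) :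
    a ^ β ≠ 0 ∧ a ^ β ≠ ∞ :=
  ⟨by simp [ENNReal.rpow_eq_zero_iff, ha, ha'], ENNReal.rpow_ne_top_of_nonneg hβ ha'⟩

/-- A measurable function with finite modular over a ball is integrable there. -/
lemma integrable_indicator_of_lintegral_le (hΦ : IsYoung Φ) {β : ℝ} (hβ : β ∈ Ioo (0 : ℝ) 1)
    {f : E n → 𝕜} (hf : AEStronglyMeasurable f) {x : E n} {r : ℝ} {c : ℝ≥0∞} (hc : c ≠ 0)
    (hc' : c ≠ ∞) (h : ∫⁻ y in Metric.ball x r, Φ ((‖f y‖ₑ / c) ^ (1 / β)) ≤ 1) :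
    Integrable ((Metric.ball x r).indicator f) := by
  rw [integrable_indicator_iff measurableSet_ball]
  refine ⟨hf.restrict, ?_⟩
  set a := youngInv Φ 1
  have ha : a ≠ ∞ := hΦ.youngInv_ne_top ENNReal.one_ne_top
  have hB := volume_ball_ne_top x r
  -- Since `1 / β > 1`, `u ≤ max 1 (u ^ (1 / β))`, and `Φ` dominates a linear function.
  have h1 : ∀ u : ℝ≥0∞, u ≤ 1 + 2 * a * (1 + Φ (u ^ (1 / β))) := by
    intro u
    rcases le_total u 1 with hu | hu
    · exact hu.trans le_self_add
    · have h2 := hΦ.mul_le one_ne_zero ENNReal.one_ne_top (u ^ (1 / β))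
      rw [mul_one] at h2
      refine le_trans ?_ (h2.trans le_add_self)
      calc u = u ^ (1 : ℝ) := (ENNReal.rpow_one u).symm
        _ ≤ u ^ (1 / β) := ENNReal.rpow_le_rpow_of_exponent_le hu
            ((one_le_div hβ.1).2 hβ.2.le)
  calc ∫⁻ y in Metric.ball x r, ‖f y‖ₑ = c * ∫⁻ y in Metric.ball x r, ‖f y‖ₑ / c := by
        rw [← lintegral_const_mul' _ _ hc']
        congr with y
        rw [ENNReal.mul_div_cancel hc hc']
    _ ≤ c * ∫⁻ y in Metric.ball x r, (1 + 2 * a * (1 + Φ ((‖f y‖ₑ / c) ^ (1 / β)))) :=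
        mul_le_mul_right (lintegral_mono fun y => h1 _) _
    _ = c * (volume (Metric.ball x r) + 2 * a * (volume (Metric.ball x r) +
          ∫⁻ y in Metric.ball x r, Φ ((‖f y‖ₑ / c) ^ (1 / β)))) := by
        rw [lintegral_add_left measurable_const, lintegral_const_mul' _ _ (by finiteness),
          lintegral_add_left measurable_const, setLIntegral_const, one_mul]
    _ ≤ c * (volume (Metric.ball x r) + 2 * a * (volume (Metric.ball x r) + 1)) := by gcongr
    _ < ∞ := by
        exact (by finiteness :
          c * (volume (Metric.ball x r) + 2 * a * (volume (Metric.ball x r) + 1)) ≠ ∞).lt_top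

variable {β : ℝ} {η : ℝ → ℝ}

lemma aestronglyMeasurable_fracInt (hn : n ≠ 0)
    (hρm : AEMeasurable ρ (volume.restrict (Ioi 0))) {f : E n → 𝕜} (hf : AEStronglyMeasurable f) :
    AEStronglyMeasurable (fracInt ρ f) :=
  (aestronglyMeasurable_fracIntegrand hn hρm hf).integral_prod_right'

/-- The estimates are proved for every `N` strictly above the norm, which also covers norm zero;
this recovers the norm itself. -/
lemma le_coe_mul_of_forall_lt {C : ℝ≥0∞} (hC : C ≠ ∞) {a b : ℝ≥0∞}
    (hb : b ≠ ∞) (h : ∀ N, N ≠ ∞ → b < N → a ≤ C * N) : a ≤ C.toNNReal * b := by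
  rw [ENNReal.coe_toNNReal hC]
  refine ENNReal.le_mul_of_forall_lt (.inr hb) (.inl hC) fun C' hC' N hN => ?_
  rcases eq_or_ne N ∞ with rfl | hN'
  · rw [ENNReal.mul_top (zero_le.trans_lt hC').ne']
    exact le_top
  · exact (h N hN' hN).trans (by gcongr)

/-- Adams type theorem, weak type. -/
theorem fracWeakBounded_of_le (hn : n ≠ 0) (hΦ : IsYoung Φ) (hφ : MemG n Φ φ)
    (hdec : AlmostDecreasing φ) (hφm : AEMeasurable φ (volume.restrict (Ioi 0)))
    (hρm : AEMeasurable ρ (volume.restrict (Ioi 0))) (hρ : SupCondition ρ)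
    (hρ_pos : ∀ t, 0 < t → 0 < ρ t) (hβ : β ∈ Ioo (0 : ℝ) 1)
    (hη : ∀ t, 0 < t → η t = φ t ^ β) {C : ℝ≥0∞} (hC : C ≠ ∞)
    (h : ∀ r, 0 < r → ENNReal.ofReal (φ r) * rhoInt ρ r + tailInt ρ φ r ≤
      C * ENNReal.ofReal (φ r) ^ β) :
    FracWeakBounded 𝕜 n ρ Φ φ (fun t => Φ (t ^ (1 / β))) η := by
  obtain ⟨A, hA, hA', hI⟩ := exists_lintegral_enorm_fracIntegrand_le (𝕜 := 𝕜) hn hΦ hφ hdec hφm hρm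
    hρ hρ_pos hβ hC h
  obtain ⟨B, hB, hB', hM⟩ := exists_volume_lt_maximal_le hn hΦ hφ hdec
  have hBβ := rpow_ne_zero_ne_top hB hB' hβ.1.le
  have hAB : A * B ^ β ≠ ∞ := ENNReal.mul_ne_top hA' hBβ.2
  have key : ∀ f : E n → 𝕜, AEStronglyMeasurable f → ∀ N, N ≠ ∞ → morreyNorm Φ φ f < N →
      ∀ x₀ r, 0 < r → weakOrliczNorm (fun t => Φ (t ^ (1 / β)))
        ((Metric.ball x₀ r).indicator (fracInt ρ f)) ≤ A * B ^ β * N * scale n Φ φ r ^ β := by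
    intro f hf N hN' hN x₀ r hr
    obtain ⟨g, hg, -, hgN, -, hle⟩ := hI f N hf hN' hN
    have hN0 : N ≠ 0 := (zero_le.trans_lt hN).ne'
    have hS := hφ.scale_ne_zero hΦ hr
    have hS' := scale_ne_top (n := n) (φ := φ) hΦ hr
    have hSβ := rpow_ne_zero_ne_top hS hS' hβ.1.le
    refine iSup₂_le fun l hl => luxemburg_le
      (mul_ne_zero (mul_ne_zero (mul_ne_zero hA hBβ.1) hN0) hSβ.1)
      (ENNReal.mul_ne_top (ENNReal.mul_ne_top hAB hN') hSβ.2) ?_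
    set W := A * B ^ β * N * scale n Φ φ r ^ β with hW
    set T := B * (N * scale n Φ φ r) with hT
    have hT0 : T ≠ 0 := mul_ne_zero hB (mul_ne_zero hN0 hS)
    have hT' : T ≠ ∞ := ENNReal.mul_ne_top hB' (ENNReal.mul_ne_top hN' hS')
    set Z : Set (E n) := Metric.ball x₀ r ∩ {x | ((l : ℝ≥0∞) / W) ^ (1 / β) * T < maximal g x}
    have hsub : ∀ x, ((l : ℝ≥0∞) < ‖(Metric.ball x₀ r).indicator (fracInt ρ f) x‖ₑ) → x ∈ Z := by
      intro x hx
      by_cases hxB : x ∈ Metric.ball x₀ r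
      · refine ⟨hxB, ?_⟩
        rw [indicator_of_mem hxB] at hx
        by_contra hc
        exact absurd (le_of_le_div_rpow_one_div hβ.1 hA hA' hB hB' hN0 hN' hS hS' (hle x)
          (not_lt.1 hc)) (not_le.2 hx)
      · simp [indicator_of_notMem hxB] at hx
    calc _ ≤ ∫⁻ x, Z.indicator (fun _ => Φ (((l : ℝ≥0∞) / W) ^ (1 / β))) x := by
          refine lintegral_mono fun x => ?_
          by_cases hx : (l : ℝ≥0∞) < ‖(Metric.ball x₀ r).indicator (fracInt ρ f) x‖ₑ
          · rw [indicator_of_mem (hsub x hx)]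
            refine hΦ.mono ?_
            gcongr
            · exact one_div_nonneg.2 hβ.1.le
            · exact indicator_le_self' (fun _ _ => zero_le) _
          · have h0 : {x | (l : ℝ≥0∞) < ‖(Metric.ball x₀ r).indicator (fracInt ρ f) x‖ₑ}.indicator
                (fun _ => (l : ℝ≥0∞)) x = 0 := indicator_of_notMem
                (show x ∉ {x | (l : ℝ≥0∞) < ‖(Metric.ball x₀ r).indicator (fracInt ρ f) x‖ₑ} from hx) _
            simp only [h0, ENNReal.zero_div, ENNReal.zero_rpow_of_pos (one_div_pos.2 hβ.1),
              hΦ.map_zero]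
            exact zero_le
      _ ≤ volume Z * Φ (((l : ℝ≥0∞) / W) ^ (1 / β)) := by
          rw [mul_comm]; exact lintegral_indicator_const_le _ _
      _ ≤ 1 := by
          have h5 := hM N g hN0 hN' hg hgN x₀ r hr (((l : ℝ≥0∞) / W) ^ (1 / β) * T)
          rwa [ENNReal.mul_div_cancel_right hT0 hT'] at h5
  have hnorm : ∀ f : E n → 𝕜, AEStronglyMeasurable f → ∀ N, N ≠ ∞ → morreyNorm Φ φ f < N →
      weakMorreyNorm (fun t => Φ (t ^ (1 / β))) η (fracInt ρ f) ≤ A * B ^ β * N := by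
    intro f hf N hN' hN
    refine iSup_le fun x₀ => iSup₂_le fun r hr => ?_
    rw [inv_mul_invPow_comp_rpow hΦ hφ hβ.1 hη hr]
    exact le_of_inv_mul_le (key f hf N hN' hN x₀ r hr)
  refine ⟨(A * B ^ β).toNNReal, fun f hf => ?_⟩
  have hfm := hf.1.1
  have hN1 : morreyNorm Φ φ f < morreyNorm Φ φ f + 1 := ENNReal.lt_add_right hf.2.ne one_ne_zero
  have hN1' : morreyNorm Φ φ f + 1 ≠ ∞ := by simpa using hf.2.ne
  have hIm := aestronglyMeasurable_fracInt hn hρm hfm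
  obtain ⟨g, -, -, -, hint, -⟩ := hI f _ hfm hN1' hN1
  refine ⟨hint, ⟨⟨hIm, fun x r hr => ⟨hIm.indicator measurableSet_ball, ?_⟩⟩, ?_⟩, ?_⟩
  · refine (key f hfm _ hN1' hN1 x r hr).trans_lt ?_
    have hSβ := rpow_ne_zero_ne_top (hφ.scale_ne_zero hΦ hr) (scale_ne_top hΦ hr) hβ.1.le
    exact (ENNReal.mul_ne_top (ENNReal.mul_ne_top hAB hN1') hSβ.2).lt_top
  · exact (hnorm f hfm _ hN1' hN1).trans_lt (ENNReal.mul_ne_top hAB hN1').lt_top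
  · exact le_coe_mul_of_forall_lt hAB hf.2.ne fun N hN' hN => hnorm f hfm N hN' hN

/-- Adams type theorem, strong type. -/
theorem fracBounded_of_le (hn : n ≠ 0) (hΦ : IsYoung Φ) (hN2 : Nabla2 Φ) (hφ : MemG n Φ φ)
    (hdec : AlmostDecreasing φ) (hφm : AEMeasurable φ (volume.restrict (Ioi 0)))
    (hρm : AEMeasurable ρ (volume.restrict (Ioi 0))) (hρ : SupCondition ρ)
    (hρ_pos : ∀ t, 0 < t → 0 < ρ t) (hβ : β ∈ Ioo (0 : ℝ) 1)
    (hη : ∀ t, 0 < t → η t = φ t ^ β) {C : ℝ≥0∞} (hC : C ≠ ∞)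
    (h : ∀ r, 0 < r → ENNReal.ofReal (φ r) * rhoInt ρ r + tailInt ρ φ r ≤
      C * ENNReal.ofReal (φ r) ^ β) :
    FracBounded 𝕜 n ρ Φ φ (fun t => Φ (t ^ (1 / β))) η := by
  obtain ⟨A, hA, hA', hI⟩ := exists_lintegral_enorm_fracIntegrand_le (𝕜 := 𝕜) hn hΦ hφ hdec hφm hρm
    hρ hρ_pos hβ hC h
  obtain ⟨B, hB, hB', hM⟩ := exists_lintegral_maximal_le hn hΦ hN2 hφ hdec
  have hBβ := rpow_ne_zero_ne_top hB hB' hβ.1.le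
  have hAB : A * B ^ β ≠ ∞ := ENNReal.mul_ne_top hA' hBβ.2
  have hW : ∀ N, N ≠ 0 → N ≠ ∞ → ∀ r, 0 < r → A * B ^ β * N * scale n Φ φ r ^ β ≠ 0 ∧
      A * B ^ β * N * scale n Φ φ r ^ β ≠ ∞ := fun N hN hN' r hr => by
    have hSβ := rpow_ne_zero_ne_top (hφ.scale_ne_zero hΦ hr) (scale_ne_top hΦ hr) hβ.1.le
    exact ⟨mul_ne_zero (mul_ne_zero (mul_ne_zero hA hBβ.1) hN) hSβ.1,
      ENNReal.mul_ne_top (ENNReal.mul_ne_top hAB hN') hSβ.2⟩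
  have key : ∀ f : E n → 𝕜, AEStronglyMeasurable f → ∀ N, N ≠ ∞ → morreyNorm Φ φ f < N →
      ∀ x₀ r, 0 < r → ∫⁻ x in Metric.ball x₀ r,
        Φ ((‖fracInt ρ f x‖ₑ / (A * B ^ β * N * scale n Φ φ r ^ β)) ^ (1 / β)) ≤ 1 := by
    intro f hf N hN' hN x₀ r hr
    obtain ⟨g, hg, hg', hgN, -, hle⟩ := hI f N hf hN' hN
    have hN0 : N ≠ 0 := (zero_le.trans_lt hN).ne'
    refine (lintegral_mono fun x => ?_).trans (hM N g hN0 hN' hg hg' hgN x₀ r hr)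
    exact hΦ.mono (div_rpow_one_div_le hβ.1 hB hB' hN0 hN' (hφ.scale_ne_zero hΦ hr)
      (scale_ne_top hΦ hr) (hle x))
  have key' : ∀ f : E n → 𝕜, AEStronglyMeasurable f → ∀ N, N ≠ ∞ → morreyNorm Φ φ f < N →
      ∀ x₀ r, 0 < r → ∫⁻ x, Φ ((‖(Metric.ball x₀ r).indicator (fracInt ρ f) x‖ₑ /
        (A * B ^ β * N * scale n Φ φ r ^ β)) ^ (1 / β)) ≤ 1 := by
    intro f hf N hN' hN x₀ r hr
    refine le_trans (le_of_eq ?_) (key f hf N hN' hN x₀ r hr)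
    rw [← lintegral_indicator measurableSet_ball]
    congr with x
    by_cases hx : x ∈ Metric.ball x₀ r
    · simp only [indicator_of_mem hx]
    · simp only [indicator_of_notMem hx, enorm_zero, ENNReal.zero_div,
        ENNReal.zero_rpow_of_pos (one_div_pos.2 hβ.1), hΦ.map_zero]
  have hnorm : ∀ f : E n → 𝕜, AEStronglyMeasurable f → ∀ N, N ≠ ∞ → morreyNorm Φ φ f < N →
      morreyNorm (fun t => Φ (t ^ (1 / β))) η (fracInt ρ f) ≤ A * B ^ β * N := by
    intro f hf N hN' hN
    have hN0 : N ≠ 0 := (zero_le.trans_lt hN).ne'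
    refine iSup_le fun x₀ => iSup₂_le fun r hr => ?_
    rw [inv_mul_invPow_comp_rpow hΦ hφ hβ.1 hη hr]
    exact le_of_inv_mul_le (luxemburg_le (hW N hN0 hN' r hr).1 (hW N hN0 hN' r hr).2
      (key' f hf N hN' hN x₀ r hr))
  refine ⟨(A * B ^ β).toNNReal, fun f hf => ?_⟩
  have hfm := hf.1.1
  have hN1 : morreyNorm Φ φ f < morreyNorm Φ φ f + 1 := ENNReal.lt_add_right hf.2.ne one_ne_zero
  have hN1' : morreyNorm Φ φ f + 1 ≠ ∞ := by simpa using hf.2.ne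
  have hN10 : morreyNorm Φ φ f + 1 ≠ 0 := by simp
  have hIm := aestronglyMeasurable_fracInt hn hρm hfm
  obtain ⟨g, -, -, -, hint, -⟩ := hI f _ hfm hN1' hN1
  refine ⟨hint, ⟨⟨hIm, fun x r hr => ⟨?_, ?_⟩⟩, ?_⟩, ?_⟩
  · exact (integrable_indicator_of_lintegral_le hΦ hβ hIm (hW _ hN10 hN1' r hr).1
      (hW _ hN10 hN1' r hr).2 (key f hfm _ hN1' hN1 x r hr)).locallyIntegrable
  · have hc := hW _ hN10 hN1' r hr
    refine ⟨(A * B ^ β * (morreyNorm Φ φ f + 1) * scale n Φ φ r ^ β)⁻¹.toNNReal, ?_, ?_⟩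
    · exact ENNReal.toNNReal_pos (ENNReal.inv_ne_zero.2 hc.2) (ENNReal.inv_ne_top.2 hc.1)
    · refine lt_of_le_of_lt ?_ ENNReal.one_lt_top
      rw [ENNReal.coe_toNNReal (ENNReal.inv_ne_top.2 hc.1)]
      simp_rw [← ENNReal.div_eq_inv_mul]
      exact key' f hfm _ hN1' hN1 x r hr
  · exact (hnorm f hfm _ hN1' hN1).trans_lt (ENNReal.mul_ne_top hAB hN1').lt_top
  · exact le_coe_mul_of_forall_lt hAB hf.2.ne fun N hN' hN => hnorm f hfm N hN' hN

end FracIntegral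

/-! ### Necessity: testing on balls -/

section Necessity

variable {𝕜 : Type*} [RCLike 𝕜] {n : ℕ} {Φ Θ : ℝ≥0∞ → ℝ≥0∞} {φ η : ℝ → ℝ} {ρ : ℝ → ℝ} {β : ℝ}

lemma lintegral_le_one_of_le_indicator (hΦ : IsYoung Φ) {g : E n → ℝ≥0∞} {z : E n} {s : ℝ}
    (hs : 0 < s) (hg : ∀ y, g y ≤ (Metric.ball z s).indicator 1 y) :
    ∫⁻ y, Φ (invPow n Φ s / (2 * (1 + volume (Metric.ball (0 : E n) 1))) * g y) ≤ 1 := by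
  set c := invPow n Φ s / (2 * (1 + volume (Metric.ball (0 : E n) 1))) with hc
  calc ∫⁻ y, Φ (c * g y) ≤ ∫⁻ y, (Metric.ball z s).indicator (fun _ => Φ c) y := by
        refine lintegral_mono fun y => ?_
        have h1 := hg y
        by_cases hy : y ∈ Metric.ball z s
        · rw [indicator_of_mem hy] at h1 ⊢
          exact hΦ.mono (mul_le_of_le_one_right zero_le h1)
        · rw [indicator_of_notMem hy] at h1 ⊢
          rw [nonpos_iff_eq_zero.1 h1, mul_zero, hΦ.map_zero]
    _ = volume (Metric.ball z s) * Φ c := by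
        rw [lintegral_indicator_const measurableSet_ball, mul_comm]
    _ ≤ 1 := hΦ.volume_ball_mul_le z hs one_ne_zero le_rfl (by rw [div_one])

lemma luxemburg_le_of_le_indicator (hΦ : IsYoung Φ) {g : E n → ℝ≥0∞} {z : E n} {s : ℝ}
    (hs : 0 < s) (hg : ∀ y, g y ≤ (Metric.ball z s).indicator 1 y) :
    luxemburg Φ g ≤ 2 * (1 + volume (Metric.ball (0 : E n) 1)) / invPow n Φ s := by
  have hω := volume_ball_ne_top (0 : E n) 1
  have ha := hΦ.invPow_ne_zero (n := n) hs
  have ha' := hΦ.invPow_ne_top (n := n) s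
  refine luxemburg_le (ENNReal.div_pos (by simp) ha').ne'
    (ENNReal.div_ne_top (by finiteness) ha) ?_
  refine le_trans (le_of_eq ?_) (lintegral_le_one_of_le_indicator hΦ hs hg)
  congr with y
  rw [div_eq_mul_inv, ENNReal.inv_div (.inl ha') (.inl ha), mul_comm]

/-- Characteristic functions of balls belong to the Orlicz-Morrey space. -/
lemma exists_morreyNorm_indicator_le (𝕜 : Type*) [RCLike 𝕜] (hΦ : IsYoung Φ) (hφ : MemG n Φ φ)
    (hdec : AlmostDecreasing φ) :
    ∃ A : ℝ≥0∞, A ≠ ∞ ∧ ∀ R, 0 < R →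
      MemMorrey Φ φ ((Metric.ball (0 : E n) R).indicator fun _ => (1 : 𝕜)) ∧
      morreyNorm Φ φ ((Metric.ball (0 : E n) R).indicator fun _ => (1 : 𝕜)) ≤
        A / ENNReal.ofReal (φ R) := by
  obtain ⟨D₁, hD₁, h₁⟩ := hφ.exists_scale_le hΦ
  obtain ⟨D₂, -, hD₂, h₂⟩ := hφ.exists_le_mul hΦ hdec 1
  set c := 2 * (1 + volume (Metric.ball (0 : E n) 1)) with hc
  have hc' : c ≠ ∞ := by
    have := volume_ball_ne_top (0 : E n) 1
    finiteness
  refine ⟨c * (D₁ + D₂), by finiteness, fun R hR => ?_⟩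
  set f : E n → 𝕜 := (Metric.ball (0 : E n) R).indicator fun _ => 1 with hf
  have hfint : Integrable f := by
    rw [integrable_indicator_iff measurableSet_ball]
    exact integrableOn_const (volume_ball_ne_top _ _)
  have hF0 : ENNReal.ofReal (φ R) ≠ 0 := by simpa using hφ.pos R hR
  have hle : ∀ (x : E n) (r : ℝ) (y : E n),
      ‖(Metric.ball x r).indicator f y‖ₑ ≤ (Metric.ball (0 : E n) R).indicator 1 y ∧
      ‖(Metric.ball x r).indicator f y‖ₑ ≤ (Metric.ball x r).indicator 1 y := by
    intro x r y
    by_cases h1 : y ∈ Metric.ball x r <;> by_cases h2 : y ∈ Metric.ball (0 : E n) R <;>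
      simp only [hf, indicator_of_mem, indicator_of_notMem, h1, h2, not_false_eq_true, enorm_zero,
        enorm_one, Pi.one_apply, le_refl, zero_le, and_self]
  have hnorm : morreyNorm Φ φ f ≤ c * (D₁ + D₂) / ENNReal.ofReal (φ R) := by
    refine iSup_le fun x => iSup₂_le fun r hr => ?_
    have hS := hφ.scale_ne_zero hΦ hr
    have h3 : (ENNReal.ofReal (φ r))⁻¹ * invPow n Φ r = (scale n Φ φ r)⁻¹ := by
      rw [scale, ENNReal.inv_div (.inl (hΦ.invPow_ne_top r)) (.inl (hΦ.invPow_ne_zero hr)),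
        div_eq_mul_inv, mul_comm]
    rw [h3]
    refine le_of_inv_mul_le ?_
    have h4 : ∀ s, 0 < s → c / invPow n Φ s = c * (scale n Φ φ s / ENNReal.ofReal (φ s)) := by
      intro s hs
      have hs0 : ENNReal.ofReal (φ s) ≠ 0 := by simpa using hφ.pos s hs
      rw [scale, div_eq_mul_inv, div_eq_mul_inv, div_eq_mul_inv,
        mul_right_comm (ENNReal.ofReal (φ s)), ENNReal.mul_inv_cancel hs0 ENNReal.ofReal_ne_top,
        one_mul]
    -- For `r ≤ R` compare with the characteristic function of `B(x, r)` and use that `φ` is almost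
    -- decreasing; for `r ≥ R` compare with that of `B(0, R)` and use that `scale` is almost
    -- increasing.
    rcases le_total r R with hrR | hrR
    · refine (luxemburg_le_of_le_indicator hΦ hr fun y => (hle x r y).2).trans ?_
      have hr0 : ENNReal.ofReal (φ r) ≠ 0 := by simpa using hφ.pos r hr
      have h5 : (ENNReal.ofReal (φ r))⁻¹ ≤ D₂ * (ENNReal.ofReal (φ R))⁻¹ := by
        have := h₂ R r hR hr (by linarith)
        rw [← div_eq_mul_inv, ENNReal.le_div_iff_mul_le (.inl hF0) (.inl ENNReal.ofReal_ne_top),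
          ← ENNReal.div_eq_inv_mul]
        exact ENNReal.div_le_of_le_mul this
      rw [h4 r hr]
      calc c * (scale n Φ φ r / ENNReal.ofReal (φ r))
          ≤ c * (scale n Φ φ r * (D₂ * (ENNReal.ofReal (φ R))⁻¹)) := by
            rw [div_eq_mul_inv]; gcongr
        _ = c * D₂ / ENNReal.ofReal (φ R) * scale n Φ φ r := by
            rw [div_eq_mul_inv]; ring
        _ ≤ _ := by gcongr; exact le_add_self
    · refine (luxemburg_le_of_le_indicator hΦ hR fun y => (hle x r y).1).trans ?_
      rw [h4 R hR]
      calc c * (scale n Φ φ R / ENNReal.ofReal (φ R))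
          ≤ c * (D₁ * scale n Φ φ r / ENNReal.ofReal (φ R)) := by
            gcongr; exact h₁ R r hR hrR
        _ = c * D₁ / ENNReal.ofReal (φ R) * scale n Φ φ r := by
            simp only [div_eq_mul_inv]; ring
        _ ≤ _ := by gcongr; exact le_self_add
  refine ⟨⟨⟨hfint.1, fun x r hr => ⟨(hfint.indicator measurableSet_ball).locallyIntegrable,
    (invPow n Φ R / c).toNNReal, ?_, ?_⟩⟩, ?_⟩, hnorm⟩
  · exact ENNReal.toNNReal_pos (ENNReal.div_pos (hΦ.invPow_ne_zero hR) hc').ne'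
      (ENNReal.div_ne_top (hΦ.invPow_ne_top R) (by simp [hc]))
  · rw [ENNReal.coe_toNNReal (ENNReal.div_ne_top (hΦ.invPow_ne_top R) (by simp [hc]))]
    exact (lintegral_le_one_of_le_indicator hΦ hR fun y => (hle x r y).1).trans_lt
      ENNReal.one_lt_top
  · exact hnorm.trans_lt (ENNReal.div_ne_top (by finiteness) hF0).lt_top

lemma lintegral_fracKernel_ball (hn : n ≠ 0) (hρm : AEMeasurable ρ (volume.restrict (Ioi 0)))
    (x : E n) (r : ℝ) :
    ∫⁻ y in Metric.ball x r, fracKernel ρ (x - y) =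
      n * volume (Metric.ball (0 : E n) 1) * rhoInt ρ r := by
  set F : ℝ → ℝ≥0∞ := (Iio r).indicator fun t => ENNReal.ofReal (ρ t / t ^ n) with hF
  have hFm : AEMeasurable F (volume.restrict (Ioi 0)) :=
    (hρm.div (by fun_prop : Measurable fun t : ℝ => t ^ n).aemeasurable).ennreal_ofReal.indicator
      measurableSet_Iio
  calc ∫⁻ y in Metric.ball x r, fracKernel ρ (x - y) = ∫⁻ y, F ‖x - y‖ := by
        rw [← lintegral_indicator measurableSet_ball]
        congr with y
        by_cases hy : y ∈ Metric.ball x r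
        · rw [indicator_of_mem hy, hF, indicator_of_mem, fracKernel]
          rwa [Metric.mem_ball, dist_comm, dist_eq_norm] at hy
        · rw [indicator_of_notMem hy, hF, indicator_of_notMem]
          rwa [Metric.mem_ball, dist_comm, dist_eq_norm] at hy
    _ = ∫⁻ z : E n, F ‖z‖ := lintegral_sub_left_eq_self (fun z : E n => F ‖z‖) x
    _ = n * volume (Metric.ball (0 : E n) 1) *
          ∫⁻ t in Ioi (0 : ℝ), ENNReal.ofReal (t ^ (n - 1)) * F t :=
        lintegral_fun_norm_of_aemeasurable hn hFm
    _ = _ := by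
        congr 1
        rw [rhoInt, ← Ioi_inter_Iio, inter_comm, ← Measure.restrict_restrict measurableSet_Iio,
          ← lintegral_indicator measurableSet_Iio]
        refine setLIntegral_congr_fun measurableSet_Ioi fun t ht => ?_
        have ht0 : (0 : ℝ) < t := ht
        by_cases htr : t ∈ Iio r
        · simp only [hF, indicator_of_mem htr]
          rw [← ENNReal.ofReal_mul (by positivity)]
          congr 1
          obtain ⟨m, rfl⟩ := Nat.exists_eq_succ_of_ne_zero hn
          rw [Nat.succ_sub_one, pow_succ]
          field_simp
        · simp only [hF, indicator_of_notMem htr, mul_zero]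

/-- The integrand is real and nonnegative, so there is no cancellation and the Bochner integral
equals the integral of the norm. -/
lemma enorm_fracInt_indicator (hn : n ≠ 0) (hρ_pos : ∀ t, 0 < t → 0 < ρ t) {s : Set (E n)}
    {x : E n} (hint : Integrable (fracIntegrand ρ (s.indicator fun _ => (1 : 𝕜)) x)) :
    ‖fracInt ρ (s.indicator fun _ => (1 : 𝕜)) x‖ₑ =
      ∫⁻ y, fracKernel ρ (x - y) * s.indicator 1 y := by
  set f : E n → 𝕜 := s.indicator fun _ => (1 : 𝕜) with hf
  have h1 : ∀ y, fracIntegrand ρ f x y = ((‖fracIntegrand ρ f x y‖ : ℝ) : 𝕜) := by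
    intro y
    have hnn : 0 ≤ ρ ‖x - y‖ / ‖x - y‖ ^ n := by
      rcases eq_or_ne x y with rfl | hxy
      · simp [hn]
      · have := norm_pos_iff.2 (sub_ne_zero.2 hxy)
        exact div_nonneg (hρ_pos _ this).le (by positivity)
    by_cases hy : y ∈ s
    · simp only [fracIntegrand, hf, indicator_of_mem hy, mul_one, RCLike.real_smul_eq_coe_mul,
        RCLike.norm_ofReal, abs_of_nonneg hnn]
    · simp [fracIntegrand, hf, indicator_of_notMem hy]
  have h2 : fracInt ρ f x = ((∫ y, ‖fracIntegrand ρ f x y‖ : ℝ) : 𝕜) := by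
    rw [fracInt, ← integral_ofReal]
    exact integral_congr_ae (.of_forall h1)
  have h3 : ‖fracInt ρ f x‖ₑ = ENNReal.ofReal (∫ y, ‖fracIntegrand ρ f x y‖) := by
    rw [h2, ← ofReal_norm, RCLike.norm_ofReal,
      abs_of_nonneg (integral_nonneg fun y => norm_nonneg _)]
  rw [h3, ofReal_integral_norm_eq_lintegral_enorm hint]
  congr with y
  rw [enorm_fracIntegrand hn hρ_pos]
  congr 1
  by_cases hy : y ∈ s <;> simp [hf, hy]

/-- The level set at height `l` fills the ball up to a null set, so every admissible `m` in the
Luxemburg infimum has `volume B * Θ (l / m) ≤ 1`. The function `Θ` is left general so that both `id`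
and `Ψ` are covered. -/
lemma le_mul_weakMorreyNorm {K : ℝ≥0∞} (hK0 : K ≠ 0) (hK : K ≠ ∞) {r : ℝ} (hr : 0 < r)
    (hη : 0 < η r) (hΘ0 : invPow n Θ r ≠ 0) (hΘ' : invPow n Θ r ≠ ∞)
    (hΘ : ∀ u, volume (Metric.ball (0 : E n) r) * Θ u ≤ 1 → u ≤ K * invPow n Θ r)
    {f : E n → 𝕜} {l : ℝ≥0} (hl : 0 < l)
    (hf : ∀ᵐ x, x ∈ Metric.ball (0 : E n) r → (l : ℝ≥0∞) < ‖f x‖ₑ) :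
    (l : ℝ≥0∞) ≤ K * ENNReal.ofReal (η r) * weakMorreyNorm Θ η f := by
  set B := Metric.ball (0 : E n) r with hB
  have hη0 : ENNReal.ofReal (η r) ≠ 0 := by simpa using hη
  have h1 : (l : ℝ≥0∞) ≤ K * invPow n Θ r * weakOrliczNorm Θ (B.indicator f) := by
    refine le_trans ?_ (mul_le_mul_right (le_iSup₂ (f := fun (l : ℝ≥0) (_ : 0 < l) =>
      luxemburg Θ ({x | (l : ℝ≥0∞) < ‖B.indicator f x‖ₑ}.indicator fun _ => (l : ℝ≥0∞))) l hl) _)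
    have hmem : ∀ m : ℝ≥0∞, 0 < m → m < ∞ → ∫⁻ x, Θ ({x | (l : ℝ≥0∞) <
        ‖B.indicator f x‖ₑ}.indicator (fun _ => (l : ℝ≥0∞)) x / m) ≤ 1 →
        (l : ℝ≥0∞) ≤ K * invPow n Θ r * m := by
      intro m hm hm' hi
      rw [← ENNReal.div_le_iff hm.ne' hm'.ne]
      refine hΘ _ (le_trans ?_ hi)
      calc volume B * Θ (l / m) = ∫⁻ x in B, Θ (l / m) := by rw [setLIntegral_const, mul_comm]
        _ ≤ ∫⁻ x in B, Θ ({x | (l : ℝ≥0∞) < ‖B.indicator f x‖ₑ}.indicator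
              (fun _ => (l : ℝ≥0∞)) x / m) := by
            refine lintegral_mono_ae ?_
            filter_upwards [ae_restrict_of_ae hf, ae_restrict_mem measurableSet_ball] with x hx hxB
            rw [indicator_of_mem (show x ∈ {x | (l : ℝ≥0∞) < ‖B.indicator f x‖ₑ} from ?_)]
            rw [mem_ofPred_eq, indicator_of_mem hxB]
            exact hx hxB
        _ ≤ _ := setLIntegral_le_lintegral _ _
    have h0 : K * invPow n Θ r ≠ 0 := mul_ne_zero hK0 hΘ0
    have h0' : K * invPow n Θ r ≠ ∞ := ENNReal.mul_ne_top hK hΘ'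
    rw [mul_comm, ← ENNReal.div_le_iff h0 h0']
    refine le_sInf fun m hm => ?_
    rw [ENNReal.div_le_iff h0 h0', mul_comm]
    exact hmem m hm.1 hm.2.1 hm.2.2
  refine h1.trans ?_
  have h2 : (ENNReal.ofReal (η r))⁻¹ * invPow n Θ r * weakOrliczNorm Θ (B.indicator f) ≤
      weakMorreyNorm Θ η f :=
    le_iSup_of_le (0 : E n) (le_iSup₂ (f := fun (r : ℝ) (_ : 0 < r) =>
      (ENNReal.ofReal (η r))⁻¹ * invPow n Θ r *
        weakOrliczNorm Θ ((Metric.ball (0 : E n) r).indicator f)) r hr)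
  calc K * invPow n Θ r * weakOrliczNorm Θ (B.indicator f)
      = K * (ENNReal.ofReal (η r) * (ENNReal.ofReal (η r))⁻¹) *
          (invPow n Θ r * weakOrliczNorm Θ (B.indicator f)) := by
        rw [ENNReal.mul_inv_cancel hη0 ENNReal.ofReal_ne_top, mul_one, mul_assoc]
    _ = K * ENNReal.ofReal (η r) *
          ((ENNReal.ofReal (η r))⁻¹ * invPow n Θ r * weakOrliczNorm Θ (B.indicator f)) := by ring
    _ ≤ _ := by gcongr

/-- Boundedness of `I_ρ` tested on characteristic functions of balls. -/
theorem exists_mul_rhoInt_le (hn : n ≠ 0) (hΦ : IsYoung Φ) (hφ : MemG n Φ φ)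
    (hdec : AlmostDecreasing φ) (hρm : AEMeasurable ρ (volume.restrict (Ioi 0)))
    (hρ_pos : ∀ t, 0 < t → 0 < ρ t) (hη : ∀ t, 0 < t → 0 < η t) {K : ℝ≥0∞} (hK0 : K ≠ 0)
    (hK : K ≠ ∞) (hΘ0 : ∀ r, 0 < r → invPow n Θ r ≠ 0) (hΘ' : ∀ r, 0 < r → invPow n Θ r ≠ ∞)
    (hΘ : ∀ r, 0 < r → ∀ u, volume (Metric.ball (0 : E n) r) * Θ u ≤ 1 → u ≤ K * invPow n Θ r)
    (h : ∃ C : ℝ≥0, ∀ f : E n → 𝕜, MemMorrey Φ φ f → (∀ᵐ x, Integrable (fracIntegrand ρ f x)) ∧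
      weakMorreyNorm Θ η (fracInt ρ f) ≤ C * morreyNorm Φ φ f) :
    ∃ C : ℝ, 0 < C ∧ ∀ r, 0 < r →
      ENNReal.ofReal (φ r) * rhoInt ρ r ≤ ENNReal.ofReal (C * η r) := by
  obtain ⟨C, hC⟩ := h
  obtain ⟨A, hA, hball⟩ := exists_morreyNorm_indicator_le (n := n) 𝕜 hΦ hφ hdec
  obtain ⟨D, -, hD, hdbl⟩ := hφ.exists_le_mul hΦ hdec 2
  set ω := n * volume (Metric.ball (0 : E n) 1) with hω
  have hω0 : ω ≠ 0 := mul_ne_zero (by simpa using hn) (volume_ball_ne_zero _ one_pos)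
  have hω' : ω ≠ ∞ := ENNReal.mul_ne_top (by simp) (volume_ball_ne_top _ _)
  set L := K * C * A * D / ω with hL
  have hL' : L ≠ ∞ := ENNReal.div_ne_top (by finiteness) hω0
  refine ⟨L.toReal + 1, by positivity, fun r hr => ?_⟩
  -- With radius `2 * r`, the ball `B(x, r)` lies in the support for every `x` in `B(0, r)`.
  obtain ⟨hmem, hnorm⟩ := hball (2 * r) (by positivity)
  set f : E n → 𝕜 := (Metric.ball (0 : E n) (2 * r)).indicator fun _ => (1 : 𝕜) with hf
  obtain ⟨hint, hbd⟩ := hC f hmem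
  have hF0 : ENNReal.ofReal (φ r) ≠ 0 := by simpa using hφ.pos r hr
  have hF2 : ENNReal.ofReal (φ (2 * r)) ≠ 0 := by simpa using hφ.pos (2 * r) (by positivity)
  have hlow : ∀ᵐ x, x ∈ Metric.ball (0 : E n) r → ω * rhoInt ρ r ≤ ‖fracInt ρ f x‖ₑ := by
    filter_upwards [hint] with x hx hxr
    rw [hf, enorm_fracInt_indicator hn hρ_pos hx, hω, ← lintegral_fracKernel_ball hn hρm x r,
      ← lintegral_indicator measurableSet_ball]
    refine lintegral_mono fun y => ?_
    by_cases hy : y ∈ Metric.ball x r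
    · rw [indicator_of_mem hy, indicator_of_mem, Pi.one_apply, mul_one]
      rw [Metric.mem_ball] at *
      linarith [dist_triangle y x 0]
    · rw [indicator_of_notMem hy]
      exact zero_le
  have hfin : ω * rhoInt ρ r ≤ K * ENNReal.ofReal (η r) * (C * (A / ENNReal.ofReal (φ (2 * r)))) := by
    -- Testing at finite levels below `ω * rhoInt ρ r` gives the strict inequality required by the
    -- weak norm, and does not presuppose that `rhoInt ρ r` is finite.
    refine le_of_forall_lt fun l hl => ?_
    obtain ⟨l', hl1, hl2⟩ := ENNReal.lt_iff_exists_nnreal_btwn.1 hl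
    have hl0 : 0 < l' := by exact_mod_cast zero_le.trans_lt hl1
    refine hl1.trans_le ((le_mul_weakMorreyNorm hK0 hK hr (hη r hr) (hΘ0 r hr) (hΘ' r hr) (hΘ r hr)
      hl0 ?_).trans (mul_le_mul_right (hbd.trans (by gcongr)) _))
    filter_upwards [hlow] with x hx hxr
    exact hl2.trans_le (hx hxr)
  have hdbl2 : ENNReal.ofReal (φ r) ≤ D * ENNReal.ofReal (φ (2 * r)) :=
    hdbl r (2 * r) hr (by positivity) le_rfl
  have h1 : ENNReal.ofReal (φ r) * rhoInt ρ r ≤ L * ENNReal.ofReal (η r) := by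
    rw [hL, ← ENNReal.mul_le_mul_iff_right hω0 hω']
    calc ω * (ENNReal.ofReal (φ r) * rhoInt ρ r)
        = ENNReal.ofReal (φ r) * (ω * rhoInt ρ r) := by ring
      _ ≤ D * ENNReal.ofReal (φ (2 * r)) *
            (K * ENNReal.ofReal (η r) * (C * (A / ENNReal.ofReal (φ (2 * r))))) := by gcongr
      _ = K * C * A * D * ENNReal.ofReal (η r) *
            (ENNReal.ofReal (φ (2 * r)) * (ENNReal.ofReal (φ (2 * r)))⁻¹) := by
          rw [div_eq_mul_inv]; ring
      _ = ω * (K * C * A * D / ω) * ENNReal.ofReal (η r) := by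
          rw [ENNReal.mul_inv_cancel hF2 ENNReal.ofReal_ne_top, mul_one,
            ENNReal.mul_div_cancel hω0 hω']
      _ = _ := by ring
  refine h1.trans ?_
  rw [ENNReal.ofReal_mul (by positivity)]
  gcongr
  rw [← ENNReal.ofReal_toReal hL']
  exact ENNReal.ofReal_le_ofReal (by simp)

lemma le_mul_invPow_id {r : ℝ} (hr : 0 < r) {u : ℝ≥0∞}
    (h : volume (Metric.ball (0 : E n) r) * u ≤ 1) :
    u ≤ (1 + (volume (Metric.ball (0 : E n) 1))⁻¹) * invPow n id r := by
  set ω := volume (Metric.ball (0 : E n) 1)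
  have hω : ω ≠ 0 := volume_ball_ne_zero _ one_pos
  have hω' : ω ≠ ∞ := volume_ball_ne_top _ _
  set s := ENNReal.ofReal (r ^ n)⁻¹ with hs
  have hsB : s * volume (Metric.ball (0 : E n) r) = ω := ofReal_inv_pow_mul_volume_ball 0 hr
  have h1 : ω * u ≤ s := by
    rw [← hsB, mul_assoc]
    exact mul_le_of_le_one_right zero_le h
  calc u = ω⁻¹ * (ω * u) := by rw [← mul_assoc, ENNReal.inv_mul_cancel hω hω', one_mul]
    _ ≤ (1 + ω⁻¹) * s := by gcongr; exact le_add_self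
    _ ≤ _ := by gcongr; exact le_youngInv_of_map_le monotone_id le_rfl

lemma invPow_id (n : ℕ) (r : ℝ) : invPow n id r = ENNReal.ofReal (r ^ n)⁻¹ :=
  le_antisymm (le_of_forall_gt_imp_ge_of_dense fun c hc =>
    sInf_le (show c ∈ {u | ENNReal.ofReal (r ^ n)⁻¹ < id u} from hc)) (le_youngInv_of_map_le monotone_id le_rfl)

lemma IsYoung.le_mul_invPow_comp_rpow (hΦ : IsYoung Φ) (hβ : 0 < β) {r : ℝ} (hr : 0 < r) {u : ℝ≥0∞}
    (h : volume (Metric.ball (0 : E n) r) * Φ (u ^ (1 / β)) ≤ 1) :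
    u ≤ (1 + (volume (Metric.ball (0 : E n) 1))⁻¹) ^ β *
      invPow n (fun t => Φ (t ^ (1 / β))) r := by
  have hω : volume (Metric.ball (0 : E n) 1) ≠ 0 := volume_ball_ne_zero _ one_pos
  rw [invPow_comp_rpow hβ, ← ENNReal.mul_rpow_of_nonneg _ _ hβ.le, ← ENNReal.rpow_inv_le_iff hβ,
    ← one_div]
  refine (le_youngInv_of_map_le hΦ.mono ?_).trans
    (hΦ.youngInv_mul_le le_self_add (ENNReal.add_ne_top.2 ⟨by simp, by simp [hω]⟩) _)
  exact (le_mul_invPow_id hr h).trans_eq (by rw [invPow_id])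

end Necessity

/-! ### From the one-sided condition to the full condition -/

section Characterization

variable {n : ℕ} {Φ : ℝ≥0∞ → ℝ≥0∞} {φ ρ : ℝ → ℝ} {β : ℝ}

/-- The supremum condition and the one-sided integral condition bound `ρ φ` pointwise. -/
lemma exists_ofReal_mul_le_rpow (hΦ : IsYoung Φ) (hφ : MemG n Φ φ) (hdec : AlmostDecreasing φ)
    (hρ : SupCondition ρ) (hβ : 0 < β) {C : ℝ≥0∞} (hC : C ≠ ∞)
    (h : ∀ r, 0 < r → ENNReal.ofReal (φ r) * rhoInt ρ r ≤ C * ENNReal.ofReal (φ r) ^ β) :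
    ∃ B : ℝ≥0∞, B ≠ ∞ ∧ ∀ r, 0 < r →
      ENNReal.ofReal (ρ r) * ENNReal.ofReal (φ r) ≤ B * ENNReal.ofReal (φ r) ^ β := by
  obtain ⟨C₁, k₁, k₂, hC₁, hk₁, hk, hsup⟩ := hρ
  have hk₂ := hk₁.trans hk
  obtain ⟨D₁, -, hD₁, h₁⟩ := hφ.exists_le_mul hΦ hdec k₂
  obtain ⟨D₂, -, hD₂, h₂⟩ := hφ.exists_le_mul hΦ hdec k₂⁻¹
  have hD₂' : D₂ ^ β ≠ ∞ := ENNReal.rpow_ne_top_of_nonneg hβ.le hD₂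
  refine ⟨ENNReal.ofReal C₁ * D₁ * C * D₂ ^ β, by finiteness, fun r hr => ?_⟩
  have hkr : 0 < k₂ * r := by positivity
  -- Condition (b) at `r`, with its interval of integration enlarged to `(0, k₂ r)`; the two
  -- doubling constants then move `φ` between `r` and `k₂ r`.
  have h3 : ENNReal.ofReal (ρ r) ≤ ENNReal.ofReal C₁ * rhoInt ρ (k₂ * r) := by
    refine (le_iSup₂ (f := fun t (_ : t ∈ Icc (r / 2) r) => ENNReal.ofReal (ρ t)) r
      ⟨by linarith, le_rfl⟩).trans ((hsup r hr).trans ?_)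
    gcongr
    exact lintegral_mono_set (Ioo_subset_Ioo_left (by positivity))
  calc ENNReal.ofReal (ρ r) * ENNReal.ofReal (φ r)
      ≤ ENNReal.ofReal C₁ * rhoInt ρ (k₂ * r) * (D₁ * ENNReal.ofReal (φ (k₂ * r))) := by
        gcongr
        exact h₁ r _ hr hkr le_rfl
    _ = ENNReal.ofReal C₁ * D₁ * (ENNReal.ofReal (φ (k₂ * r)) * rhoInt ρ (k₂ * r)) := by ring
    _ ≤ ENNReal.ofReal C₁ * D₁ * (C * (D₂ * ENNReal.ofReal (φ r)) ^ β) := by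
        refine mul_le_mul_right ((h _ hkr).trans ?_) _
        gcongr
        exact h₂ _ r hkr hr (by rw [inv_mul_cancel_left₀ hk₂.ne'])
    _ = _ := by rw [ENNReal.mul_rpow_of_nonneg _ _ hβ.le]; ring

end Characterization

end OrliczMorrey

/-! ### Assembly of the three parts -/

theorem mainTheorem4 {𝕜 : Type*} [RCLike 𝕜] (n : ℕ) (hn : 1 ≤ n)
    (Φ : ℝ≥0∞ → ℝ≥0∞) (hΦ : OrliczMorrey.IsYoung Φ)
    (φ : ℝ → ℝ) (hφ_meas : AEMeasurable φ (volume.restrict (Ioi 0)))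
    (hφ : OrliczMorrey.MemG n Φ φ) (hφ_dec : OrliczMorrey.AlmostDecreasing φ)
    (β : ℝ) (hβ : β ∈ Ioo (0 : ℝ) 1)
    (η : ℝ → ℝ) (hη : ∀ t, 0 < t → η t = φ t ^ β)
    (Ψ : ℝ≥0∞ → ℝ≥0∞) (hΨ : ∀ t, Ψ t = Φ (t ^ (1 / β)))
    (ρ : ℝ → ℝ) (hρ_meas : AEMeasurable ρ (volume.restrict (Ioi 0)))
    (hρ_pos : ∀ t, 0 < t → 0 < ρ t) :
    -- Part 1: sufficiency
    (OrliczMorrey.rhoInt ρ 1 < ∞ → OrliczMorrey.SupCondition ρ →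
      (∃ C : ℝ, 0 < C ∧ ∀ r, 0 < r →
        ENNReal.ofReal (φ r) * OrliczMorrey.rhoInt ρ r + OrliczMorrey.tailInt ρ φ r
          ≤ ENNReal.ofReal (C * η r)) →
      OrliczMorrey.FracWeakBounded 𝕜 n ρ Φ φ Ψ η ∧
      (OrliczMorrey.Nabla2 Φ → OrliczMorrey.FracBounded 𝕜 n ρ Φ φ Ψ η)) ∧
    -- Part 2: necessity
    (OrliczMorrey.FracWeakBounded 𝕜 n ρ Φ φ id η ∨ OrliczMorrey.FracBounded 𝕜 n ρ Φ φ Ψ η →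
      ∃ C : ℝ, 0 < C ∧ ∀ r, 0 < r →
        ENNReal.ofReal (φ r) * OrliczMorrey.rhoInt ρ r ≤ ENNReal.ofReal (C * η r)) ∧
    -- Part 3: characterization
    (OrliczMorrey.rhoInt ρ 1 < ∞ → OrliczMorrey.SupCondition ρ →
      (∃ C : ℝ, 0 < C ∧ ∀ r, 0 < r →
        OrliczMorrey.tailInt ρ φ r ≤ ENNReal.ofReal (C * (ρ r * φ r))) →
      ((∃ C : ℝ, 0 < C ∧ ∀ r, 0 < r →
          ENNReal.ofReal (φ r) * OrliczMorrey.rhoInt ρ r ≤ ENNReal.ofReal (C * η r)) ↔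
        OrliczMorrey.FracWeakBounded 𝕜 n ρ Φ φ Ψ η) ∧
      (OrliczMorrey.Nabla2 Φ →
        ((∃ C : ℝ, 0 < C ∧ ∀ r, 0 < r →
            ENNReal.ofReal (φ r) * OrliczMorrey.rhoInt ρ r ≤ ENNReal.ofReal (C * η r)) ↔
          OrliczMorrey.FracBounded 𝕜 n ρ Φ φ Ψ η))) := by
  have hn0 : n ≠ 0 := Nat.one_le_iff_ne_zero.1 hn
  have hβ0 := hβ.1
  obtain rfl : Ψ = fun t => Φ (t ^ (1 / β)) := funext hΨ
  have hηpos : ∀ t, 0 < t → 0 < η t := fun t ht => by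
    rw [hη t ht]; exact Real.rpow_pos_of_pos (hφ.pos t ht) _
  have hηeq : ∀ C r, 0 < C → 0 < r →
      ENNReal.ofReal (C * η r) = ENNReal.ofReal C * ENNReal.ofReal (φ r) ^ β := fun C r hC hr => by
    rw [ENNReal.ofReal_mul hC.le, hη r hr, ENNReal.ofReal_rpow_of_pos (hφ.pos r hr)]
  have hmono : Monotone fun t => Φ (t ^ (1 / β)) := fun s t hst =>
    hΦ.mono (ENNReal.rpow_le_rpow hst (one_div_nonneg.2 hβ0.le))
  -- Compares the inverse at `1 / volume (B(0, r))` with the inverse at `r^{-n}`: `K` serves for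
  -- `id` and `K ^ β` for `Ψ`.
  set K : ℝ≥0∞ := 1 + (volume (Metric.ball (0 : OrliczMorrey.E n) 1))⁻¹ with hK
  have hK0 : K ≠ 0 := by simp [hK]
  have hK' : K ≠ ∞ := ENNReal.add_ne_top.2
    ⟨by simp, by simpa using OrliczMorrey.volume_ball_ne_zero (0 : OrliczMorrey.E n) one_pos⟩
  have hKβ := OrliczMorrey.rpow_ne_zero_ne_top hK0 hK' hβ0.le
  have hinv : ∀ r, 0 < r → OrliczMorrey.invPow n (fun t => Φ (t ^ (1 / β))) r ≠ 0 ∧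
      OrliczMorrey.invPow n (fun t => Φ (t ^ (1 / β))) r ≠ ∞ := fun r hr => by
    rw [OrliczMorrey.invPow_comp_rpow hβ0]
    exact OrliczMorrey.rpow_ne_zero_ne_top (hΦ.invPow_ne_zero hr) (hΦ.invPow_ne_top r) hβ0.le
  have necΨ : OrliczMorrey.FracWeakBounded 𝕜 n ρ Φ φ (fun t => Φ (t ^ (1 / β))) η →
      ∃ C : ℝ, 0 < C ∧ ∀ r, 0 < r →
        ENNReal.ofReal (φ r) * OrliczMorrey.rhoInt ρ r ≤ ENNReal.ofReal (C * η r) := by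
    rintro ⟨C, hC⟩
    exact OrliczMorrey.exists_mul_rhoInt_le hn0 hΦ hφ hφ_dec hρ_meas hρ_pos hηpos hKβ.1 hKβ.2
      (fun r hr => (hinv r hr).1) (fun r hr => (hinv r hr).2)
      (fun r hr u hu => hΦ.le_mul_invPow_comp_rpow hβ0 hr hu)
      ⟨C, fun f hf => ⟨(hC f hf).1, (hC f hf).2.2⟩⟩
  have necStrong : OrliczMorrey.FracBounded 𝕜 n ρ Φ φ (fun t => Φ (t ^ (1 / β))) η →
      ∃ C : ℝ, 0 < C ∧ ∀ r, 0 < r →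
        ENNReal.ofReal (φ r) * OrliczMorrey.rhoInt ρ r ≤ ENNReal.ofReal (C * η r) := by
    rintro ⟨C, hC⟩
    exact OrliczMorrey.exists_mul_rhoInt_le hn0 hΦ hφ hφ_dec hρ_meas hρ_pos hηpos hKβ.1 hKβ.2
      (fun r hr => (hinv r hr).1) (fun r hr => (hinv r hr).2)
      (fun r hr u hu => hΦ.le_mul_invPow_comp_rpow hβ0 hr hu)
      ⟨C, fun f hf => ⟨(hC f hf).1,
        (OrliczMorrey.weakMorreyNorm_le_morreyNorm hmono η _).trans (hC f hf).2.2⟩⟩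
  have necId : OrliczMorrey.FracWeakBounded 𝕜 n ρ Φ φ id η →
      ∃ C : ℝ, 0 < C ∧ ∀ r, 0 < r →
        ENNReal.ofReal (φ r) * OrliczMorrey.rhoInt ρ r ≤ ENNReal.ofReal (C * η r) := by
    rintro ⟨C, hC⟩
    exact OrliczMorrey.exists_mul_rhoInt_le hn0 hΦ hφ hφ_dec hρ_meas hρ_pos hηpos hK0 hK'
      (fun r hr => by
        rw [OrliczMorrey.invPow_id]; exact OrliczMorrey.ofReal_inv_pow_ne_zero n hr)
      (fun r _ => by rw [OrliczMorrey.invPow_id]; exact ENNReal.ofReal_ne_top)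
      (fun r hr u hu => OrliczMorrey.le_mul_invPow_id hr hu)
      ⟨C, fun f hf => ⟨(hC f hf).1, (hC f hf).2.2⟩⟩
  have suff : ∀ C : ℝ≥0∞, C ≠ ∞ → OrliczMorrey.SupCondition ρ →
      (∀ r, 0 < r → ENNReal.ofReal (φ r) * OrliczMorrey.rhoInt ρ r + OrliczMorrey.tailInt ρ φ r ≤
        C * ENNReal.ofReal (φ r) ^ β) →
      OrliczMorrey.FracWeakBounded 𝕜 n ρ Φ φ (fun t => Φ (t ^ (1 / β))) η ∧
      (OrliczMorrey.Nabla2 Φ →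
        OrliczMorrey.FracBounded 𝕜 n ρ Φ φ (fun t => Φ (t ^ (1 / β))) η) := fun C hC hsup hle =>
    ⟨OrliczMorrey.fracWeakBounded_of_le hn0 hΦ hφ hφ_dec hφ_meas hρ_meas hsup hρ_pos hβ hη hC hle,
      fun hN2 => OrliczMorrey.fracBounded_of_le hn0 hΦ hN2 hφ hφ_dec hφ_meas hρ_meas hsup hρ_pos hβ
        hη hC hle⟩
  refine ⟨?_, ?_, ?_⟩
  · rintro - hsup ⟨C, hC, hle⟩
    exact suff (ENNReal.ofReal C) ENNReal.ofReal_ne_top hsup fun r hr =>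
      (hle r hr).trans_eq (hηeq C r hC hr)
  · rintro (h | h)
    · exact necId h
    · exact necStrong h
  · rintro - hsup ⟨C₁, hC₁, htail⟩
    have main : (∃ C : ℝ, 0 < C ∧ ∀ r, 0 < r →
          ENNReal.ofReal (φ r) * OrliczMorrey.rhoInt ρ r ≤ ENNReal.ofReal (C * η r)) →
        OrliczMorrey.FracWeakBounded 𝕜 n ρ Φ φ (fun t => Φ (t ^ (1 / β))) η ∧
        (OrliczMorrey.Nabla2 Φ →
          OrliczMorrey.FracBounded 𝕜 n ρ Φ φ (fun t => Φ (t ^ (1 / β))) η) := by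
      rintro ⟨C, hC, hle⟩
      have hle' : ∀ r, 0 < r → ENNReal.ofReal (φ r) * OrliczMorrey.rhoInt ρ r ≤
          ENNReal.ofReal C * ENNReal.ofReal (φ r) ^ β := fun r hr =>
        (hle r hr).trans_eq (hηeq C r hC hr)
      -- The bound of `ρ φ` by `φ ^ β` converts the tail hypothesis into the second half of the
      -- sufficient condition.
      obtain ⟨B, hB, hρφ⟩ := OrliczMorrey.exists_ofReal_mul_le_rpow hΦ hφ hφ_dec hsup hβ0
        ENNReal.ofReal_ne_top hle'
      refine suff (ENNReal.ofReal C + ENNReal.ofReal C₁ * B) (by finiteness) hsup fun r hr => ?_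
      rw [add_mul]
      refine add_le_add (hle' r hr) ((htail r hr).trans ?_)
      rw [ENNReal.ofReal_mul hC₁.le, ENNReal.ofReal_mul (hρ_pos r hr).le, mul_assoc]
      exact mul_le_mul_right (hρφ r hr) _
    exact ⟨⟨fun h => (main h).1, necΨ⟩, fun hN2 => ⟨fun h => (main h).2 hN2, necStrong⟩⟩
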